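/- **Definitions.** For $-\tfrac12<\kappa<\tfrac12$, $0\le\delta<\tfrac12$ and $0<v<1$ let $$f_1(\kappa,\delta;v)=v^{\kappa/2}(1-v)^{-\kappa/2}\,{}_2F_1\!\left(\delta,-\delta;\tfrac12+\kappa;v\right),$$ $$f_2(\kappa,\delta;v)=\frac{\delta}{\frac12+\kappa}\,v^{(\kappa+1)/2}(1-v)^{(1-\kappa)/2}\,{}_2F_1\!\left(1+\delta,1-\delta;\tfrac32+\kappa;v\right),$$ $$H(\kappa,\delta)=\frac{\Gamma(\frac12+\kappa)^2}{\Gamma(\frac12+\kappa+\delta)\,\Gamma(\frac12+\kappa-\delta)}$$ (with $1/\Gamma=0$ at the poles of $\Gamma$), and $$G_1(\kappa,\delta;v)=\big(f_1(\kappa,\delta;v)^2+f_2(\kappa,\delta;v)^2\big)H(-\kappa,\delta)+\big(f_1(-\kappa,\delta;v)^2+f_2(-\kappa,\delta;v)^2\big)H(\kappa,\delta).$$ For $0<\phi<\pi$ and $v=\sin^2\frac\phi2$ put $$L(\phi)=\begin{bmatrix} f_1(\kappa,\delta;v)&f_2(\kappa,\delta;v)\\-f_2(-\kappa,\delta;v)&f_1(-\kappa,\delta;v)\end{bmatrix}\begin{bmatrix}\cos\delta\phi&-\sin\delta\phi\\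 \sin\delta\phi&\cos\delta\phi\end{bmatrix},\qquad K_c(\phi)=c\,L(\phi)^T\begin{bmatrix}H(-\kappa,\delta)&0\\0&H(\kappa,\delta)\end{bmatrix}L(\phi)\quad(c\in\mathbb R),$$ and for a real $2\times2$ matrix $K$ put $K^{\mathbb C}=BKB^*$ with $B=\begin{bmatrix}1&\mathrm i\\1&-\mathrm i\end{bmatrix}$. Let $m\ge3$ and $1\le\ell\le\lfloor\frac{m-1}2\rfloor$ be integers, $\omega=e^{2\pi\mathrm i/m}$, and let the dihedral group $W$ of order $2m$ act on $\mathbb C$ from the right by the reflections $z\sigma_j=\overline z\omega^j$ and the rotations $z\varrho_j=z\omega^j$. With $\alpha_j=2\pi\ell j/m$, its representation $\tau_\ell$ in real coordinates is $$\tau_\ell(\sigma_j)=\begin{bmatrix}\cos\alpha_j&\sin\alpha_j\\ \sin\alpha_j&-\cos\alpha_j\end{bmatrix},\qquad \tau_\ell(\varrho_j)=\begin{bmatrix}\cos\alpha_j&\sin\alpha_j\\ -\sin\alpha_j&\cos\alpha_j\end{bmatrix}.$$ For $\delta=\frac12-\frac\ell m$, the weight $K_c$ on $\mathbb C$ is defined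 (off the reflection lines) by $K_c(re^{\mathrm i\theta})=K_c(\phi)|_{\phi=m\theta}$ for $r>0$, $0<\theta<\frac\pi m$, and $K_c(zw)=\tau_\ell(w)^{-1}K_c(z)\tau_\ell(w)$ for $w\in W$. **Proposition (normalizing integral).** Suppose $-\frac12<\kappa<\frac12$ and $0\le\delta<\frac12$. 1. The function $G_1(\kappa,\delta;v)(v(1-v))^{-1/2}$ is integrable on $(0,1)$ and $$\int_0^1G_1(\kappa,\delta;v)\,(v(1-v))^{-1/2}\,dv=2\pi\,\frac{\cos\delta\pi}{\cos\kappa\pi}.$$ 2. This determines the normalizing constant: for every integer $m\ge3$ and every real $c$, the normalization $$m\int_0^{\pi/m}\big(K_c^{\mathbb C}(m\theta)_{11}+K_c^{\mathbb C}(m\theta)_{22}\big)\,d\theta=2$$ holds if and only if $$c=c(\kappa,\delta):=\frac{\cos\pi\kappa}{2\pi\cos\pi\delta}.$$ Likewise, if $\delta=\frac12-\frac\ell m$ with integers $m\ge3$ and $1\le\ell\le\lfloor\frac{m-1}2\rfloor$, then for every real $c$ the Gaussian normalization $$\int_{\mathbb C}K_c^{\mathbb C}(z)_{11}\,e^{-|z|^2/2}\,dm_2(z)=2,$$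 where $m_2$ is Lebesgue measure on the plane, holds if and only if $c=c(\kappa,\delta)$. -/

import Mathlib

namespace DihedralWeight

open Matrix

/-- `f₁(κ,δ;v) = v^{κ/2} (1-v)^{-κ/2} ₂F₁(δ,-δ;1/2+κ;v)`, for `0 < v < 1`. -/
noncomputable def f₁ (κ δ v : ℝ) : ℝ :=
  v ^ (κ / 2) * (1 - v) ^ (-κ / 2) * ordinaryHypergeometric δ (-δ) (1 / 2 + κ) v

/-- `f₂(κ,δ;v) = δ/(1/2+κ) v^{(κ+1)/2} (1-v)^{(1-κ)/2} ₂F₁(1+δ,1-δ;3/2+κ;v)`, for `0 < v < 1`. -/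
noncomputable def f₂ (κ δ v : ℝ) : ℝ :=
  δ / (1 / 2 + κ) * v ^ ((κ + 1) / 2) * (1 - v) ^ ((1 - κ) / 2) *
    ordinaryHypergeometric (1 + δ) (1 - δ) (3 / 2 + κ) v

/-- `H(κ,δ) = Γ(1/2+κ)² / (Γ(1/2+κ+δ) Γ(1/2+κ-δ))`. Where the denominator has a pole, the quotient
is zero; this agrees with the conventions `Real.Gamma (-n) = 0` and `x / 0 = 0`. -/
noncomputable def H (κ δ : ℝ) : ℝ :=
  Real.Gamma (1 / 2 + κ) ^ 2 / (Real.Gamma (1 / 2 + κ + δ) * Real.Gamma (1 / 2 + κ - δ))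

/-- `G₁(κ,δ;v)`. -/
noncomputable def G₁ (κ δ v : ℝ) : ℝ :=
  (f₁ κ δ v ^ 2 + f₂ κ δ v ^ 2) * H (-κ) δ + (f₁ (-κ) δ v ^ 2 + f₂ (-κ) δ v ^ 2) * H κ δ

/-- The fundamental solution `L(φ) = M_f(sin²(φ/2)) M_δ(φ)`, for `0 < φ < π`. -/
noncomputable def L (κ δ φ : ℝ) : Matrix (Fin 2) (Fin 2) ℝ :=
  let v := Real.sin (φ / 2) ^ 2
  !![f₁ κ δ v, f₂ κ δ v; -f₂ (-κ) δ v, f₁ (-κ) δ v] *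
    !![Real.cos (δ * φ), -Real.sin (δ * φ); Real.sin (δ * φ), Real.cos (δ * φ)]

/-- The matrix weight with constant factor `c` on the fundamental chamber, in real coordinates,
as a function of `φ = m θ ∈ (0,π)`: `c L(φ)ᵀ diag(H(-κ,δ), H(κ,δ)) L(φ)`. -/
noncomputable def chamberWeight (c κ δ φ : ℝ) : Matrix (Fin 2) (Fin 2) ℝ :=
  c • ((L κ δ φ)ᵀ * !![H (-κ) δ, 0; 0, H κ δ] * L κ δ φ)

/-- Change of coordinates of a form from the real basis `s₁, s₂` to the complex basis
`t = s₁ + i s₂`, `t̄ = s₁ - i s₂`: `K ↦ B K B*`. -/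
noncomputable def toComplexBasis (K : Matrix (Fin 2) (Fin 2) ℝ) : Matrix (Fin 2) (Fin 2) ℂ :=
  !![1, Complex.I; 1, -Complex.I] * K.map Complex.ofReal * (!![1, Complex.I; 1, -Complex.I])ᴴ

/-- The representation `τ_ℓ` of the dihedral group of order `2m`, in real coordinates, at the
reflection `σ_j : z ↦ z̄ ω^j`, where `ω = e^{2πi/m}`. -/
noncomputable def tauReflection (m ℓ : ℕ) (j : ℤ) : Matrix (Fin 2) (Fin 2) ℝ :=
  let α : ℝ := 2 * Real.pi * ℓ * j / m
  !![Real.cos α, Real.sin α; Real.sin α, -Real.cos α]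

/-- `τ_ℓ` at the rotation `ϱ_j = σ_0 σ_j : z ↦ z ω^j` (the group acts on the right), that is,
`τ_ℓ(σ_0) τ_ℓ(σ_j)`. -/
noncomputable def tauRotation (m ℓ : ℕ) (j : ℤ) : Matrix (Fin 2) (Fin 2) ℝ :=
  let α : ℝ := 2 * Real.pi * ℓ * j / m
  !![Real.cos α, Real.sin α; -Real.sin α, Real.cos α]

/-- The matrix weight with constant factor `c` on the whole plane, for `δ = 1/2 - ℓ/m`. On the
fundamental chamber `0 < θ < π/m` it is `chamberWeight` at `φ = m θ`; the other chambers are reached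
by `K(z w) = τ_ℓ(w)⁻¹ K(z) τ_ℓ(w)`, where `w` is the rotation `ϱ_j` if `θ = 2πj/m + ψ` with
`0 < ψ < π/m`, and the reflection `σ_{j+1}` if `π/m < ψ < 2π/m`. (The values on the walls, a null
set, are immaterial.) -/
noncomputable def planeWeight (m ℓ : ℕ) (c κ : ℝ) (z : ℂ) : Matrix (Fin 2) (Fin 2) ℝ :=
  let δ : ℝ := 1 / 2 - ℓ / m
  let j : ℤ := ⌊m * z.arg / (2 * Real.pi)⌋
  let ψ : ℝ := z.arg - 2 * Real.pi * j / m
  if ψ ≤ Real.pi / m then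
    (tauRotation m ℓ j)⁻¹ * chamberWeight c κ δ (m * ψ) * tauRotation m ℓ j
  else
    (tauReflection m ℓ (j + 1))⁻¹ * chamberWeight c κ δ (m * (2 * Real.pi / m - ψ)) *
      tauReflection m ℓ (j + 1)

end DihedralWeight

open Filter Topology MeasureTheory Set

namespace DihedralWeight

/-! Put `c = 1/2 + κ`, so that `0 < c < 1`, and `w_c(v) = v^{c-1} (1-v)^{-c}`. Stripped of their
power factors, `f₁` and `f₂` become `u₁ = ₂F₁(δ,-δ;c;v)` and a function `u₂` with `u₂(0) = 0`, and
they solve the first-order system `u₁' = -δ w_{1-c} u₂`, `u₂' = δ w_c u₁`. The power factors and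
`(v(1-v))^{-1/2}` combine so that `(f₁² + f₂²)(v(1-v))^{-1/2} = w_c u₁² + w_{1-c} u₂²`
(`f₁_sq_add_f₂_sq`).

Write `a`, `a'` for the values `u₁(1)` with parameters `c`, `1-c`. By Gauss's summation
(`ordinaryHypergeometric_one`) these are `H(κ,δ)` and `H(-κ,δ)`. The system has two conserved
bilinear expressions: one shows that `u₂(1) = b` is the same for `c` and `1-c`, the other that `a a'
+ b² = 1`. The reflection formula for `Γ` then gives `b = sin πδ / sin πc` (`sol₂_one`).

For two parameters `δ`, `δ'` the derivative of `u₁(δ) u₂(δ') - u₂(δ) u₁(δ')` is `δ' - δ` times the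
polarized density (`sub_mul_integral_pairing`). Formally, `δ' → δ` gives integrals `J = a ∂b - b ∂a`
and `J' = a' ∂b - b ∂a'`, with `∂` the derivative in `δ`. The required integral is `a' J + a J' = 2
a a' ∂b - b ∂(a a') = 2(1 - b²) ∂b + 2 b² ∂b = 2 ∂b = 2π cos πδ / sin πc`, and `sin πc = cos πκ`
(`integral_pairing_combination`).

For the constants, only traces matter. Every chamber has the same trace `c G₁(sin²(mθ/2))` (here `c`
is the constant factor), and `v = sin²(φ/2)` turns `(v(1-v))^{-1/2} dv` into `dφ`. Both
normalizations become `2c` times the integral just found. -/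

/-! ### Coefficients of the hypergeometric series -/

/-- The coefficients `(a)_k (b)_k / ((c)_k k!)` of `₂F₁(a,b;c)`. -/
noncomputable def hyperCoeff (a b c : ℝ) (k : ℕ) : ℝ :=
  ordinaryHypergeometricCoefficient a b c k

theorem hyperCoeff_succ (a b c : ℝ) (k : ℕ) :
    hyperCoeff a b c (k + 1) =
      hyperCoeff a b c k * ((a + k) * (b + k) / ((c + k) * (k + 1))) := by
  simp only [hyperCoeff, ordinaryHypergeometricCoefficient, ascPochhammer_succ_eval,
    Nat.factorial_succ]
  push_cast
  simp only [mul_inv, div_eq_mul_inv]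
  ring

theorem hyperCoeff_zero (a b c : ℝ) :
    hyperCoeff a b c 0 = 1 := by
  simp [hyperCoeff, ordinaryHypergeometricCoefficient]

theorem ordinaryHypergeometric_eq_tsum_mul (a b c x : ℝ) :
    ordinaryHypergeometric a b c x = ∑' k, hyperCoeff a b c k * x ^ k := by
  rw [ordinaryHypergeometric_eq_tsum]
  rfl

theorem succ_mul_hyperCoeff_succ (a b c : ℝ) (hc : 0 < c) (k : ℕ) :
    (k + 1) * hyperCoeff a b c (k + 1) =
      a * b / c * hyperCoeff (a + 1) (b + 1) (c + 1) k := by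
  induction k with
  | zero =>
    rw [hyperCoeff_succ, hyperCoeff_zero,
      hyperCoeff_zero]
    simp
  | succ k ih =>
    rw [hyperCoeff_succ, hyperCoeff_succ (a + 1) (b + 1) (c + 1) k]
    have h1 : c + (k + 1 : ℕ) ≠ 0 := by positivity
    have h2 : c + 1 + (k : ℝ) ≠ 0 := by positivity
    have h3 : (k : ℝ) + 1 + 1 ≠ 0 := by positivity
    calc _ = ((k + 1) * hyperCoeff a b c (k + 1)) *
          ((a + (k + 1 : ℕ)) * (b + (k + 1 : ℕ)) / ((c + (k + 1 : ℕ)) * (k + 1))) := by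
          push_cast
          field_simp
      _ = _ := by
          rw [ih]
          push_cast
          have h4 : c + 1 + (k : ℝ) = c + (k + 1) := by ring
          rw [h4]
          ring

/-- The ratio `k! / (c)_{k+1}`. -/
noncomputable def factorialRatio (c : ℝ) (k : ℕ) : ℝ :=
  k.factorial / ∏ j ∈ Finset.range (k + 1), (c + j)

theorem factorialRatio_succ {c : ℝ} (k : ℕ) :
    factorialRatio c (k + 1) = factorialRatio c k * ((k + 1) / (c + (k + 1))) := by
  rw [factorialRatio, factorialRatio, Finset.prod_range_succ _ (k + 1), Nat.factorial_succ]
  push_cast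
  simp only [mul_inv, div_eq_mul_inv]
  ring

theorem factorialRatio_pos {c : ℝ} (hc : 0 < c) (k : ℕ) : 0 < factorialRatio c k := by
  unfold factorialRatio
  have : 0 < ∏ j ∈ Finset.range (k + 1), (c + j) := Finset.prod_pos fun j _ => by positivity
  positivity

/-- Euler's limit: the ratio equals `n^{-c}` times the `n`-th approximant of `Γ(c)`. -/
theorem factorialRatio_tendsto {c : ℝ} (hc : 0 < c) :
    Tendsto (factorialRatio c) atTop (𝓝 0) := by
  have h1 := Real.GammaSeq_tendsto_Gamma c
  have h2 : Tendsto (fun n : ℕ => (n : ℝ) ^ (-c)) atTop (𝓝 0) :=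
    (tendsto_rpow_neg_atTop hc).comp tendsto_natCast_atTop_atTop
  have h3 := h1.mul h2
  rw [mul_zero] at h3
  refine h3.congr' ?_
  filter_upwards [eventually_gt_atTop 0] with n hn
  have hn' : (0 : ℝ) < n := by exact_mod_cast hn
  rw [Real.GammaSeq, factorialRatio, Real.rpow_neg hn'.le]
  have := (Real.rpow_pos_of_pos hn' c).ne'
  field_simp

/-- Telescoping: with `r_k` the ratio, `r_k - r_{k+1} = r_k c/(c+k+1)`, while `1/(k+1) ≤
(1+c)/(c+k+1)`. The explicit bound is kept because it tends to zero as `c → ∞`, which Gauss's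
formula needs. -/
theorem sum_factorialRatio_div_le {c : ℝ} (hc : 0 < c) (n : ℕ) :
    ∑ k ∈ Finset.range n, factorialRatio c k / (k + 1) ≤ (1 + c) / c ^ 2 := by
  have key : ∑ k ∈ Finset.range n, factorialRatio c k / (k + 1) ≤
      (1 + c) / c * (factorialRatio c 0 - factorialRatio c n) := by
    induction n with
    | zero => simp
    | succ n ih =>
      rw [Finset.sum_range_succ]
      have h : factorialRatio c n / (n + 1) ≤
          (1 + c) / c * (factorialRatio c n - factorialRatio c (n + 1)) := by
        rw [factorialRatio_succ]
        have hp := factorialRatio_pos hc n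
        have e : (1 + c) / c * (factorialRatio c n - factorialRatio c n *
            ((n + 1) / (c + (n + 1)))) = factorialRatio c n * ((1 + c) / (c + (n + 1))) := by
          field_simp
          ring
        rw [e, div_eq_mul_one_div]
        refine mul_le_mul_of_nonneg_left ?_ hp.le
        rw [div_le_div_iff₀ (by positivity) (by positivity)]
        nlinarith [mul_nonneg hc.le (Nat.cast_nonneg (α := ℝ) n)]
      linarith
  have h0 : factorialRatio c 0 = 1 / c := by simp [factorialRatio]
  have hn := factorialRatio_pos hc n
  calc _ ≤ _ := key
    _ ≤ (1 + c) / c * (1 / c) := by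
      rw [h0]
      exact mul_le_mul_of_nonneg_left (by linarith) (by positivity)
    _ = _ := by field_simp

theorem summable_factorialRatio_div {c : ℝ} (hc : 0 < c) :
    Summable fun k : ℕ => factorialRatio c k / (k + 1) :=
  summable_of_sum_range_le (fun k => div_nonneg (factorialRatio_pos hc k).le (by positivity))
    (sum_factorialRatio_div_le hc)

/-- The numerator factors satisfy `|j² - δ²| ≤ j²` for `j ≥ 1`, and the factor `j = 0` is at most
`1`. The bound no longer depends on `δ`, so it can dominate limits in `δ`. -/
theorem abs_hyperCoeff_succ_le {c δ : ℝ} (hc : 0 < c) (hδ : |δ| ≤ 1) (k : ℕ) :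
    |hyperCoeff δ (-δ) c (k + 1)| ≤ factorialRatio c k / (k + 1) := by
  have hδ2 : δ ^ 2 ≤ 1 := by rw [← sq_abs]; nlinarith [abs_nonneg δ]
  induction k with
  | zero =>
    rw [hyperCoeff_succ, hyperCoeff_zero]
    have : factorialRatio c 0 = 1 / c := by simp [factorialRatio]
    rw [this]
    simp only [Nat.cast_zero, add_zero, zero_add, mul_one, one_mul, div_one]
    rw [abs_div, abs_of_pos hc]
    gcongr
    rw [abs_mul, abs_neg, abs_mul_abs_self]
    nlinarith
  | succ k ih =>
    rw [hyperCoeff_succ, abs_mul, factorialRatio_succ]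
    have e : |(δ + (k + 1 : ℕ)) * (-δ + (k + 1 : ℕ)) / ((c + (k + 1 : ℕ)) * ((k + 1 : ℕ) + 1))| ≤
        (k + 1) ^ 2 / ((c + (k + 1)) * (k + 1 + 1)) := by
      push_cast
      rw [abs_div, abs_of_pos (show 0 < (c + ((k : ℝ) + 1)) * (k + 1 + 1) by positivity)]
      gcongr
      rw [abs_le]
      constructor <;> nlinarith [sq_nonneg δ, Nat.cast_nonneg (α := ℝ) k]
    calc _ ≤ factorialRatio c k / (k + 1) * ((k + 1) ^ 2 / ((c + (k + 1)) * (k + 1 + 1))) := by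
          gcongr
          exact div_nonneg (factorialRatio_pos hc k).le (by positivity)
      _ = _ := by
          push_cast
          field_simp

/-- A summable majorant of the coefficients of `₂F₁(δ,-δ;c)`, uniform in `|δ| ≤ 1`. -/
noncomputable def hyperCoeffBound (c : ℝ) : ℕ → ℝ
  | 0 => 1
  | k + 1 => factorialRatio c k / (k + 1)

theorem summable_hyperCoeffBound {c : ℝ} (hc : 0 < c) : Summable (hyperCoeffBound c) :=
  (summable_nat_add_iff 1).1 (summable_factorialRatio_div hc)

theorem abs_hyperCoeff_le {c δ : ℝ} (hc : 0 < c) (hδ : |δ| ≤ 1) (k : ℕ) :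
    |hyperCoeff δ (-δ) c k| ≤ hyperCoeffBound c k := by
  cases k with
  | zero => rw [hyperCoeff_zero, hyperCoeffBound, abs_one]
  | succ k => exact abs_hyperCoeff_succ_le hc hδ k

theorem summable_hyperCoeff {c δ : ℝ} (hc : 0 < c) (hδ : |δ| ≤ 1) :
    Summable (hyperCoeff δ (-δ) c) :=
  .of_norm_bounded (summable_hyperCoeffBound hc) (abs_hyperCoeff_le hc hδ)

/-- Successive ratios `((k+1)² - δ²)/((c+1+k)(k+1))` lie in `[0,1]`. Boundedness gives convergence
for `|v| < 1`; nonnegativity fixes the sign of `sol₂` at `1`. -/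
theorem contiguous_hyperCoeff_nonneg_le_one {c δ : ℝ} (hc : 0 < c) (hδ : |δ| ≤ 1) (k : ℕ) :
    0 ≤ hyperCoeff (δ + 1) (-δ + 1) (c + 1) k ∧
      hyperCoeff (δ + 1) (-δ + 1) (c + 1) k ≤ 1 := by
  obtain ⟨hδ₁, hδ₂⟩ := abs_le.1 hδ
  induction k with
  | zero => exact ⟨by rw [hyperCoeff_zero]; exact zero_le_one, (hyperCoeff_zero _ _ _).le⟩
  | succ k ih =>
    rw [hyperCoeff_succ]
    have hk := Nat.cast_nonneg (α := ℝ) k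
    have h0 : 0 ≤ (δ + 1 + k) * (-δ + 1 + k) / ((c + 1 + k) * (k + 1)) :=
      div_nonneg (mul_nonneg (by linarith) (by linarith)) (by positivity)
    have h1 : (δ + 1 + k) * (-δ + 1 + k) / ((c + 1 + k) * (k + 1)) ≤ 1 := by
      rw [div_le_one (by positivity)]
      have := mul_nonneg hc.le (add_nonneg hk zero_le_one)
      linear_combination this + sq_nonneg δ
    exact ⟨mul_nonneg ih.1 h0, mul_le_one₀ ih.2 h0 h1⟩

/-! ### Power series with bounded coefficients -/

theorem summable_mul_pow_of_bounded {a : ℕ → ℝ} {C x : ℝ} (ha : ∀ k, |a k| ≤ C) (hx : |x| < 1) :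
    Summable fun k => a k * x ^ k :=
  .of_norm_bounded ((summable_geometric_of_lt_one (abs_nonneg x) hx).mul_left C) fun k => by
    rw [Real.norm_eq_abs, abs_mul, abs_pow]
    exact mul_le_mul_of_nonneg_right (ha k) (by positivity)

theorem hasDerivAt_tsum_mul_pow {a : ℕ → ℝ} {C x : ℝ} (ha : ∀ k, |a k| ≤ C) (hx : |x| < 1) :
    Summable (fun k : ℕ => (k + 1) * a (k + 1) * x ^ k) ∧
    HasDerivAt (fun y => ∑' k, a k * y ^ k) (∑' k : ℕ, (k + 1) * a (k + 1) * x ^ k) x := by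
  obtain ⟨r, hr, hr1⟩ := exists_between hx
  have hr0 : 0 < r := (abs_nonneg x).trans_lt hr
  have hC : 0 ≤ C := (abs_nonneg _).trans (ha 0)
  have hr' : ‖r‖ < 1 := by rwa [Real.norm_eq_abs, abs_of_pos hr0]
  have hs : Summable fun k : ℕ => C / r * ((k : ℝ) ^ 1 * r ^ k) :=
    Summable.mul_left (C / r) (summable_pow_mul_geometric_of_norm_lt_one (R := ℝ) 1 hr')
  have hb : ∀ (k : ℕ) (y : ℝ), y ∈ Ioo (-r) r →
      ‖a k * (k * y ^ (k - 1))‖ ≤ C / r * ((k : ℝ) ^ 1 * r ^ k) := by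
    intro k y hy
    have hy' : |y| ≤ r := (abs_lt.2 hy).le
    rw [Real.norm_eq_abs, abs_mul, abs_mul, Nat.abs_cast, abs_pow, pow_one]
    cases k with
    | zero => simp
    | succ k =>
      rw [Nat.add_sub_cancel]
      calc _ ≤ C * ((k + 1 : ℕ) * r ^ k) := by
            gcongr
            exact ha _
        _ = _ := by
            rw [pow_succ]
            field_simp
  have hxm : x ∈ Ioo (-r) r := abs_lt.1 hr
  have hd : HasDerivAt (fun y => ∑' k, a k * y ^ k) (∑' k : ℕ, a k * (k * x ^ (k - 1))) x :=
    hasDerivAt_tsum_of_isPreconnected (g := fun k y => a k * y ^ k)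
    (g' := fun k y => a k * (k * y ^ (k - 1))) hs isOpen_Ioo isPreconnected_Ioo
    (fun k y _ => (hasDerivAt_pow k y).const_mul (a k)) hb hxm
    (summable_mul_pow_of_bounded ha hx) hxm
  have hsum : Summable fun k : ℕ => a k * (k * x ^ (k - 1)) :=
    .of_norm_bounded hs fun k => hb k x hxm
  have e : ∀ k : ℕ, a (k + 1) * ((k + 1 : ℕ) * x ^ (k + 1 - 1)) =
      (k + 1) * a (k + 1) * x ^ k := by
    intro k
    rw [Nat.add_sub_cancel]
    push_cast
    ring
  have hsum' : Summable fun k : ℕ => (k + 1) * a (k + 1) * x ^ k :=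
    ((summable_nat_add_iff 1).2 hsum).congr e
  have ht : ∑' k : ℕ, a k * (k * x ^ (k - 1)) = ∑' k : ℕ, (k + 1) * a (k + 1) * x ^ k := by
    rw [hsum.tsum_eq_zero_add, tsum_congr e]
    simp
  exact ⟨hsum', ht ▸ hd⟩

/-! ### Gauss's summation formula for `₂F₁(δ,-δ;c;1)` -/

theorem hyperCoeff_add_one_right {a b c : ℝ} (hc : 0 < c) (k : ℕ) :
    hyperCoeff a b (c + 1) k = hyperCoeff a b c k * (c / (c + k)) := by
  induction k with
  | zero => simp [hyperCoeff_zero, hc.ne']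
  | succ k ih =>
    rw [hyperCoeff_succ, ih, hyperCoeff_succ a b c k]
    have h1 : c + (k : ℝ) ≠ 0 := by positivity
    have h2 : c + (k + 1 : ℝ) ≠ 0 := by positivity
    push_cast
    rw [show c + 1 + (k : ℝ) = c + (k + 1) by ring]
    field_simp

theorem ordinaryHypergeometric_one_eq_tsum (a b c : ℝ) :
    ordinaryHypergeometric a b c (1 : ℝ) = ∑' k, hyperCoeff a b c k := by
  simp [ordinaryHypergeometric_eq_tsum_mul]

theorem tendsto_nat_mul_hyperCoeff {c δ : ℝ} (hc : 0 < c) (hδ : |δ| ≤ 1) :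
    Tendsto (fun k : ℕ => k * hyperCoeff δ (-δ) c k) atTop (𝓝 0) := by
  rw [← tendsto_add_atTop_iff_nat 1]
  refine squeeze_zero_norm (fun k => ?_) (factorialRatio_tendsto hc)
  rw [Real.norm_eq_abs, abs_mul, Nat.abs_cast]
  calc _ ≤ ((k + 1 : ℕ) : ℝ) * (factorialRatio c k / (k + 1)) := by
        gcongr
        exact abs_hyperCoeff_succ_le hc hδ k
    _ = _ := by
        push_cast
        field_simp

/-- The difference of the two series telescopes: its `n`-th partial sum is `-c n A_n`, with `A_n`
the coefficient, and `n A_n → 0`. -/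
theorem ordinaryHypergeometric_one_contiguous {c δ : ℝ} (hc : 0 < c) (hδ : |δ| ≤ 1) :
    c ^ 2 * ordinaryHypergeometric δ (-δ) c (1 : ℝ) =
      (c ^ 2 - δ ^ 2) * ordinaryHypergeometric δ (-δ) (c + 1) (1 : ℝ) := by
  rw [ordinaryHypergeometric_one_eq_tsum, ordinaryHypergeometric_one_eq_tsum]
  have h1 := ((summable_hyperCoeff hc hδ).hasSum.mul_left (c ^ 2)).sub
    ((summable_hyperCoeff (add_pos hc one_pos) hδ).hasSum.mul_left (c ^ 2 - δ ^ 2))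
  have h2 := h1.tendsto_sum_nat
  have e : ∀ n : ℕ, ∑ k ∈ Finset.range n, (c ^ 2 * hyperCoeff δ (-δ) c k -
      (c ^ 2 - δ ^ 2) * hyperCoeff δ (-δ) (c + 1) k) = -(c * (n * hyperCoeff δ (-δ) c n)) := by
    intro n
    induction n with
    | zero => simp
    | succ n ih =>
      rw [Finset.sum_range_succ, ih, hyperCoeff_add_one_right hc, hyperCoeff_succ]
      have h1 : c + (n : ℝ) ≠ 0 := by positivity
      push_cast
      field_simp
      ring
  simp_rw [e] at h2
  have h3 := ((tendsto_nat_mul_hyperCoeff hc hδ).const_mul c).neg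
  rw [mul_zero, neg_zero] at h3
  exact sub_eq_zero.1 (tendsto_nhds_unique h2 h3)

theorem abs_ordinaryHypergeometric_one_sub_one_le {c δ : ℝ} (hc : 0 < c) (hδ : |δ| ≤ 1) :
    |ordinaryHypergeometric δ (-δ) c (1 : ℝ) - 1| ≤ (1 + c) / c ^ 2 := by
  rw [ordinaryHypergeometric_one_eq_tsum, (summable_hyperCoeff hc hδ).tsum_eq_zero_add,
    hyperCoeff_zero, add_sub_cancel_left]
  have h := tsum_of_norm_bounded (f := fun k => hyperCoeff δ (-δ) c (k + 1))
    (summable_factorialRatio_div hc).hasSum (fun k => abs_hyperCoeff_succ_le hc hδ k)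
  exact h.trans ((summable_factorialRatio_div hc).tsum_le_of_sum_range_le
    (sum_factorialRatio_div_le hc))

theorem ordinaryHypergeometric_one_tendsto {c δ : ℝ} (hc : 0 < c) (hδ : |δ| ≤ 1) :
    Tendsto (fun n : ℕ => ordinaryHypergeometric δ (-δ) (c + n) (1 : ℝ)) atTop (𝓝 1) := by
  rw [tendsto_iff_norm_sub_tendsto_zero]
  have h1 : Tendsto (fun n : ℕ => c + (n : ℝ)) atTop atTop :=
    tendsto_atTop_add_const_left _ _ tendsto_natCast_atTop_atTop
  have h2 : Tendsto (fun x : ℝ => x⁻¹ ^ 2 + x⁻¹) atTop (𝓝 0) := by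
    simpa using (tendsto_inv_atTop_zero.pow 2).add (tendsto_inv_atTop_zero (𝕜 := ℝ))
  refine squeeze_zero (fun _ => norm_nonneg _) (fun n => ?_) (h2.comp h1)
  have hp : 0 < c + (n : ℝ) := by positivity
  refine (abs_ordinaryHypergeometric_one_sub_one_le hp hδ).trans_eq ?_
  simp only [Function.comp]
  field_simp

theorem ordinaryHypergeometric_one_eq_prod_mul {c δ : ℝ} (hc : 0 < c) (hδ : |δ| ≤ 1) (n : ℕ) :
    ordinaryHypergeometric δ (-δ) c (1 : ℝ) =
      (∏ j ∈ Finset.range n, ((c + j) ^ 2 - δ ^ 2) / (c + j) ^ 2) *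
        ordinaryHypergeometric δ (-δ) (c + n) (1 : ℝ) := by
  induction n with
  | zero => simp
  | succ n ih =>
    have hp : 0 < c + (n : ℝ) := by positivity
    have h := ordinaryHypergeometric_one_contiguous hp hδ
    rw [ih, Finset.prod_range_succ, mul_assoc]
    congr 1
    push_cast
    rw [← add_assoc, div_mul_eq_mul_div, ← h]
    field_simp

/-- Iterating the contiguous relation leaves a finite product times the value at `c + n`, which
tends to `1`; the product is exactly a quotient of Euler approximants of `Γ`. -/
theorem ordinaryHypergeometric_one {c δ : ℝ} (hc : 0 < c) (hδ : |δ| < 1) :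
    ordinaryHypergeometric δ (-δ) c (1 : ℝ) =
      Real.Gamma c ^ 2 / (Real.Gamma (c + δ) * Real.Gamma (c - δ)) := by
  -- At a pole of the denominator the contiguous relation forces the left side to vanish, and the
  -- right side vanishes because `Real.Gamma 0 = 0`.
  by_cases h0 : (c + δ) * (c - δ) = 0
  · have h1 := ordinaryHypergeometric_one_contiguous hc hδ.le
    rw [show c ^ 2 - δ ^ 2 = (c + δ) * (c - δ) by ring, h0, zero_mul] at h1
    have h2 := (mul_eq_zero.1 h1).resolve_left (by positivity)
    rw [h2]
    rcases mul_eq_zero.1 h0 with h | h <;> simp [h, Real.Gamma_zero]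
  obtain ⟨hp, hm⟩ := mul_ne_zero_iff.1 h0
  obtain ⟨hδ₁, hδ₂⟩ := abs_lt.1 hδ
  -- Since `c ± δ > -1`, zero is the only pole of `Γ` that could occur.
  have aux : ∀ x : ℝ, -1 < x → x ≠ 0 → ∀ m : ℕ, x + m ≠ 0 := by
    intro x hx hx0 m
    cases m with
    | zero => simpa using hx0
    | succ m =>
      have : 0 < x + (m + 1 : ℕ) := by
        push_cast
        linarith [Nat.cast_nonneg (α := ℝ) m]
      exact this.ne'
  have hp' := aux (c + δ) (by linarith) hp
  have hm' := aux (c - δ) (by linarith) hm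
  have hGp : Real.Gamma (c + δ) ≠ 0 := Real.Gamma_ne_zero fun m h => hp' m (by rw [h]; ring)
  have hGm : Real.Gamma (c - δ) ≠ 0 := Real.Gamma_ne_zero fun m h => hm' m (by rw [h]; ring)
  have hlim := ((Real.GammaSeq_tendsto_Gamma c).pow 2).div
    ((Real.GammaSeq_tendsto_Gamma (c + δ)).mul (Real.GammaSeq_tendsto_Gamma (c - δ)))
    (mul_ne_zero hGp hGm)
  have hone := (tendsto_add_atTop_iff_nat 1).2 (ordinaryHypergeometric_one_tendsto hc hδ.le)
  have hmul := hlim.mul hone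
  rw [mul_one] at hmul
  refine tendsto_nhds_unique ?_ hmul
  refine tendsto_const_nhds.congr' ?_
  filter_upwards [eventually_gt_atTop 0] with n hn
  have hn' : (0 : ℝ) < n := by exact_mod_cast hn
  rw [ordinaryHypergeometric_one_eq_prod_mul hc hδ.le (n + 1)]
  congr 1
  simp only [Pi.div_apply]
  rw [Finset.prod_div_distrib, Finset.prod_pow]
  have e : ∏ j ∈ Finset.range (n + 1), ((c + (j : ℝ)) ^ 2 - δ ^ 2) =
      (∏ j ∈ Finset.range (n + 1), (c + δ + j)) * ∏ j ∈ Finset.range (n + 1), (c - δ + j) := by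
    rw [← Finset.prod_mul_distrib]
    exact Finset.prod_congr rfl fun j _ => by ring
  have hPp : ∏ j ∈ Finset.range (n + 1), (c + δ + (j : ℝ)) ≠ 0 :=
    Finset.prod_ne_zero_iff.2 fun j _ => hp' j
  have hPm : ∏ j ∈ Finset.range (n + 1), (c - δ + (j : ℝ)) ≠ 0 :=
    Finset.prod_ne_zero_iff.2 fun j _ => hm' j
  have hPc : ∏ j ∈ Finset.range (n + 1), (c + (j : ℝ)) ≠ 0 :=
    Finset.prod_ne_zero_iff.2 fun j _ => by positivity
  rw [e, Real.GammaSeq, Real.GammaSeq, Real.GammaSeq, Real.rpow_add hn', Real.rpow_sub hn']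
  have h1 := (Real.rpow_pos_of_pos hn' c).ne'
  have h2 := (Real.rpow_pos_of_pos hn' δ).ne'
  have h3 : (n.factorial : ℝ) ≠ 0 := by positivity
  field_simp

/-! ### The solution of the regularized system -/

/-- The hypergeometric function `₂F₁(δ,-δ;c;v)`, which is `f₁` without its power factors. -/
noncomputable def sol₁ (c δ v : ℝ) : ℝ := ordinaryHypergeometric δ (-δ) c v

/-- The weight `v^{c-1} (1-v)^{-c}`. -/
noncomputable def betaWeight (c v : ℝ) : ℝ := v ^ (c - 1) * (1 - v) ^ (-c)

/-- The second component of the regularized system, `f₂` without its power factors. -/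
noncomputable def sol₂ (c δ v : ℝ) : ℝ := δ * ∫ t in (0 : ℝ)..v, betaWeight c t * sol₁ c δ t

/-- A bound for `|sol₁ c δ v|`, uniform in `|δ| ≤ 1` and `v ∈ [0,1]`. -/
noncomputable def solBound (c : ℝ) : ℝ := ∑' k, hyperCoeffBound c k

theorem abs_hyperCoeff_mul_pow_le {c δ v : ℝ} (hc : 0 < c) (hδ : |δ| ≤ 1) (hv : v ∈ Icc (0 : ℝ) 1)
    (k : ℕ) : ‖hyperCoeff δ (-δ) c k * v ^ k‖ ≤ hyperCoeffBound c k := by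
  rw [Real.norm_eq_abs, abs_mul, abs_pow, abs_of_nonneg hv.1]
  calc _ ≤ |hyperCoeff δ (-δ) c k| * 1 := by
        gcongr
        exact pow_le_one₀ hv.1 hv.2
    _ ≤ _ := by rw [mul_one]; exact abs_hyperCoeff_le hc hδ k

theorem sol₁_eq_tsum (c δ v : ℝ) : sol₁ c δ v = ∑' k, hyperCoeff δ (-δ) c k * v ^ k :=
  ordinaryHypergeometric_eq_tsum_mul _ _ _ _

theorem sol₁_zero (c δ : ℝ) : sol₁ c δ 0 = 1 := ordinaryHypergeometric_zero _ _ _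

theorem sol₂_zero (c δ : ℝ) : sol₂ c δ 0 = 0 := by simp [sol₂]

theorem abs_sol₁_le {c δ v : ℝ} (hc : 0 < c) (hδ : |δ| ≤ 1) (hv : v ∈ Icc (0 : ℝ) 1) :
    |sol₁ c δ v| ≤ solBound c := by
  rw [sol₁_eq_tsum]
  exact tsum_of_norm_bounded (summable_hyperCoeffBound hc).hasSum
    (abs_hyperCoeff_mul_pow_le hc hδ hv)

theorem continuousOn_sol₁ {c δ : ℝ} (hc : 0 < c) (hδ : |δ| ≤ 1) :
    ContinuousOn (sol₁ c δ) (Icc 0 1) := by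
  have h := continuousOn_tsum (s := Icc (0 : ℝ) 1) (f := fun k v => hyperCoeff δ (-δ) c k * v ^ k)
    (fun k => by fun_prop) (summable_hyperCoeffBound hc)
    (fun k v hv => abs_hyperCoeff_mul_pow_le hc hδ hv k)
  exact h.congr fun v _ => sol₁_eq_tsum c δ v

theorem continuous_hyperCoeff_param (c : ℝ) (k : ℕ) :
    Continuous fun δ => hyperCoeff δ (-δ) c k := by
  simp only [hyperCoeff]
  fun_prop

theorem continuousOn_sol₁_param {c v : ℝ} (hc : 0 < c) (hv : v ∈ Icc (0 : ℝ) 1) :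
    ContinuousOn (fun δ => sol₁ c δ v) {δ | |δ| ≤ 1} := by
  have h := continuousOn_tsum (s := {δ : ℝ | |δ| ≤ 1})
    (f := fun k δ => hyperCoeff δ (-δ) c k * v ^ k)
    (fun k => ((continuous_hyperCoeff_param c k).mul continuous_const).continuousOn)
    (summable_hyperCoeffBound hc)
    (fun k δ hδ => abs_hyperCoeff_mul_pow_le hc hδ hv k)
  exact h.congr fun δ _ => sol₁_eq_tsum c δ v

theorem betaWeight_nonneg {c v : ℝ} (hv : v ∈ Icc (0 : ℝ) 1) : 0 ≤ betaWeight c v :=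
  mul_nonneg (Real.rpow_nonneg hv.1 _) (Real.rpow_nonneg (sub_nonneg.2 hv.2) _)

theorem betaWeight_one_sub (c v : ℝ) : betaWeight (1 - c) (1 - v) = betaWeight c v := by
  simp only [betaWeight]
  rw [mul_comm, sub_sub_cancel, show -(1 - c) = c - 1 by ring, show 1 - c - 1 = -c by ring]

theorem intervalIntegrable_betaWeight {c : ℝ} (hc : 0 < c) (hc1 : c < 1) :
    IntervalIntegrable (betaWeight c) volume 0 1 := by
  -- Only the singularity at `0` is treated; the one at `1` follows from the symmetry `v ↦ 1 - v`,
  -- `c ↦ 1 - c`.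
  have left : ∀ c : ℝ, 0 < c → IntervalIntegrable (betaWeight c) volume 0 (1 / 2) := by
    intro c hc
    refine (intervalIntegral.intervalIntegrable_rpow' (by linarith)).mul_continuousOn ?_
    refine ContinuousOn.rpow_const (by fun_prop) fun x hx => Or.inl ?_
    rw [uIcc_of_le (by norm_num)] at hx
    linarith [hx.2]
  refine (left c hc).trans ?_
  have h := (left (1 - c) (by linarith)).comp_sub_left 1
  have e : (fun x => betaWeight (1 - c) (1 - x)) = betaWeight c :=
    funext (betaWeight_one_sub c)
  rw [e] at h
  norm_num at h
  exact h.symm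

theorem continuousAt_betaWeight {c v : ℝ} (hv : v ∈ Ioo (0 : ℝ) 1) :
    ContinuousAt (betaWeight c) v := by
  refine (continuousAt_id.rpow_const (Or.inl hv.1.ne')).mul
    (ContinuousAt.rpow_const (by fun_prop) (Or.inl ?_))
  linarith [hv.2]

theorem intervalIntegrable_betaWeight_mul {c : ℝ} (hc : 0 < c) (hc1 : c < 1) {g : ℝ → ℝ}
    (hg : ContinuousOn g (Icc 0 1)) :
    IntervalIntegrable (fun v => betaWeight c v * g v) volume 0 1 :=
  (intervalIntegrable_betaWeight hc hc1).mul_continuousOn (by rwa [uIcc_of_le zero_le_one])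

theorem continuousOn_sol₂ {c δ : ℝ} (hc : 0 < c) (hc1 : c < 1) (hδ : |δ| ≤ 1) :
    ContinuousOn (sol₂ c δ) (Icc 0 1) := by
  have h := intervalIntegral.continuousOn_primitive_interval'
    (intervalIntegrable_betaWeight_mul hc hc1 (continuousOn_sol₁ hc hδ)) left_mem_uIcc
  rw [uIcc_of_le zero_le_one] at h
  exact continuousOn_const.mul h

theorem hasDerivAt_sol₂ {c δ v : ℝ} (hc : 0 < c) (hc1 : c < 1) (hδ : |δ| ≤ 1)
    (hv : v ∈ Ioo (0 : ℝ) 1) :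
    HasDerivAt (sol₂ c δ) (δ * (betaWeight c v * sol₁ c δ v)) v := by
  have hi := intervalIntegrable_betaWeight_mul hc hc1 (continuousOn_sol₁ hc hδ)
  have hcont : ∀ x ∈ Ioo (0 : ℝ) 1, ContinuousAt (fun v => betaWeight c v * sol₁ c δ v) x :=
    fun x hx => (continuousAt_betaWeight hx).mul
      ((continuousOn_sol₁ hc hδ).continuousAt (Icc_mem_nhds hx.1 hx.2))
  have hsm : StronglyMeasurableAtFilter (fun v => betaWeight c v * sol₁ c δ v) (𝓝 v) volume :=
    ContinuousAt.stronglyMeasurableAtFilter isOpen_Ioo hcont v hv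
  refine (intervalIntegral.integral_hasDerivAt_right (hi.mono_set ?_) hsm (hcont v hv)).const_mul δ
  rw [uIcc_of_le zero_le_one, uIcc_of_le hv.1.le]
  exact Icc_subset_Icc_right hv.2.le

theorem hasDerivAt_sol₁_series {c δ v : ℝ} (hc : 0 < c) (hδ : |δ| ≤ 1) (hv : v ∈ Ioo (0 : ℝ) 1) :
    HasDerivAt (sol₁ c δ)
      (-(δ ^ 2 / c) * ordinaryHypergeometric (1 + δ) (1 - δ) (c + 1) v) v := by
  have hv' : |v| < 1 := abs_lt.2 ⟨by linarith [hv.1], hv.2⟩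
  have hb : ∀ k, |hyperCoeff δ (-δ) c k| ≤ solBound c := fun k =>
    (abs_hyperCoeff_le hc hδ k).trans
      ((summable_hyperCoeffBound hc).le_tsum k fun j _ =>
        (abs_nonneg _).trans (abs_hyperCoeff_le hc hδ j))
  have h := (hasDerivAt_tsum_mul_pow hb hv').2
  have e : ∑' k : ℕ, (k + 1) * hyperCoeff δ (-δ) c (k + 1) * v ^ k =
      -(δ ^ 2 / c) * ordinaryHypergeometric (1 + δ) (1 - δ) (c + 1) v := by
    rw [ordinaryHypergeometric_eq_tsum_mul, ← tsum_mul_left]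
    refine tsum_congr fun k => ?_
    rw [succ_mul_hyperCoeff_succ _ _ _ hc, add_comm δ 1, neg_add_eq_sub]
    ring
  rw [← e]
  exact h.congr_of_eventuallyEq (Eventually.of_forall fun y => sol₁_eq_tsum c δ y)

theorem contiguous_hyperCoeff_relation {c δ : ℝ} (hc : 0 < c) (k : ℕ) :
    (k + 1 + c) * hyperCoeff (1 + δ) (1 - δ) (c + 1) (k + 1) -
      (k + 1) * hyperCoeff (1 + δ) (1 - δ) (c + 1) k = c * hyperCoeff δ (-δ) c (k + 1) := by
  have h := succ_mul_hyperCoeff_succ δ (-δ) c hc k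
  rw [add_comm δ 1, neg_add_eq_sub] at h
  have hk : (k : ℝ) + 1 ≠ 0 := by positivity
  have hck : c + 1 + (k : ℝ) ≠ 0 := by positivity
  have h' : hyperCoeff δ (-δ) c (k + 1) =
      δ * -δ / c * hyperCoeff (1 + δ) (1 - δ) (c + 1) k / (k + 1) := by
    rw [← h]
    field_simp
  rw [h', hyperCoeff_succ]
  field_simp
  ring

/-- Comparison of coefficients. The equation says that `v^c (1-v)^{1-c} ₂F₁(1+δ,1-δ;c+1;v)` has
derivative `c w_c u₁`. -/
theorem contiguous_differential_equation {c δ v : ℝ} (hc : 0 < c) (hδ : |δ| ≤ 1)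
    (hv : v ∈ Ioo (0 : ℝ) 1) :
    ∃ d, HasDerivAt (fun y : ℝ => ordinaryHypergeometric (1 + δ) (1 - δ) (c + 1) y) d v ∧
      v * (1 - v) * d + (c - v) * ordinaryHypergeometric (1 + δ) (1 - δ) (c + 1) v =
        c * sol₁ c δ v := by
  have hv' : |v| < 1 := abs_lt.2 ⟨by linarith [hv.1], hv.2⟩
  have hb : ∀ k, |hyperCoeff (1 + δ) (1 - δ) (c + 1) k| ≤ 1 := fun k => by
    have h := contiguous_hyperCoeff_nonneg_le_one hc hδ k
    rw [add_comm δ 1, neg_add_eq_sub] at h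
    rw [abs_of_nonneg h.1]
    exact h.2
  obtain ⟨hs, hd⟩ := hasDerivAt_tsum_mul_pow hb hv'
  have hs0 := summable_mul_pow_of_bounded hb hv'
  set g := hyperCoeff (1 + δ) (1 - δ) (c + 1) with hg
  refine ⟨_, hd.congr_of_eventuallyEq
    (Eventually.of_forall fun y => ordinaryHypergeometric_eq_tsum_mul _ _ _ y), ?_⟩
  rw [ordinaryHypergeometric_eq_tsum_mul, sol₁_eq_tsum, ← hg]
  have hs1 : Summable fun k : ℕ => k * g k * v ^ k := by
    refine (summable_nat_add_iff 1).1 ((hs.mul_right v).congr fun k => ?_)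
    push_cast
    ring
  have ht1 : (∑' k : ℕ, (k + 1) * g (k + 1) * v ^ k) * v = ∑' k : ℕ, k * g k * v ^ k := by
    rw [hs1.tsum_eq_zero_add, ← tsum_mul_right]
    simp only [Nat.cast_zero, zero_mul, zero_add]
    refine tsum_congr fun k => ?_
    push_cast
    ring
  have hs2 : Summable fun k : ℕ => (k + c) * g k * v ^ k :=
    (hs1.add (hs0.mul_left c)).congr fun k => by ring
  have hs3 : Summable fun k : ℕ => (k + 1) * g k * v ^ k :=
    (hs1.add hs0).congr fun k => by ring
  have ht2 : ∑' k : ℕ, (k + c) * g k * v ^ k =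
      ∑' k : ℕ, k * g k * v ^ k + c * ∑' k : ℕ, g k * v ^ k := by
    rw [← tsum_mul_left, ← hs1.tsum_add (hs0.mul_left c)]
    exact tsum_congr fun k => by ring
  have ht3 : ∑' k : ℕ, (k + 1) * g k * v ^ k =
      ∑' k : ℕ, k * g k * v ^ k + ∑' k : ℕ, g k * v ^ k := by
    rw [← hs1.tsum_add hs0]
    exact tsum_congr fun k => by ring
  have hsF : Summable fun k => hyperCoeff δ (-δ) c k * v ^ k :=
    .of_norm_bounded (summable_hyperCoeffBound hc)
      (abs_hyperCoeff_mul_pow_le hc hδ (Ioo_subset_Icc_self hv))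
  have key : ∑' k : ℕ, (k + c) * g k * v ^ k - v * ∑' k : ℕ, (k + 1) * g k * v ^ k =
      c * ∑' k, hyperCoeff δ (-δ) c k * v ^ k := by
    rw [hs2.tsum_eq_zero_add, hsF.tsum_eq_zero_add, mul_add, ← tsum_mul_left (a := v),
      ← tsum_mul_left (a := c), hyperCoeff_zero, hg, hyperCoeff_zero, ← hg, add_sub_assoc,
      ← ((summable_nat_add_iff 1).2 hs2).tsum_sub (hs3.mul_left v)]
    congr 1
    · simp
    · refine tsum_congr fun k => ?_
      have h := contiguous_hyperCoeff_relation (δ := δ) hc k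
      rw [← hg] at h
      push_cast
      linear_combination v ^ (k + 1) * h
  linear_combination key + (1 - v) * ht1 - ht2 + v * ht3

/-- The two sides have the same derivative and both vanish at `0`. The integral form remains
continuous up to `v = 1`, where the series on the right diverges because its exponent `c - 1` is
negative; the hypergeometric form links it to `f₂`. -/
theorem sol₂_eq {c δ v : ℝ} (hc : 0 < c) (hc1 : c < 1) (hδ : |δ| ≤ 1) (hv : v ∈ Ioo (0 : ℝ) 1) :
    sol₂ c δ v = δ / c * v ^ c * (1 - v) ^ (1 - c) *
      ordinaryHypergeometric (1 + δ) (1 - δ) (c + 1) v := by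
  have hderiv : ∀ x ∈ Ioo (0 : ℝ) 1, HasDerivAt (fun y : ℝ => sol₂ c δ y - δ / c * y ^ c *
      (1 - y) ^ (1 - c) * ordinaryHypergeometric (1 + δ) (1 - δ) (c + 1) y) 0 x := by
    intro x hx
    obtain ⟨d, hd, hode⟩ := contiguous_differential_equation hc hδ hx
    have hx1 : 0 < 1 - x := by linarith [hx.2]
    have h1 : HasDerivAt (fun y : ℝ => y ^ c) (c * x ^ (c - 1)) x :=
      Real.hasDerivAt_rpow_const (Or.inl hx.1.ne')
    have h2 : HasDerivAt (fun y : ℝ => (1 - y) ^ (1 - c)) (-1 * (1 - c) * (1 - x) ^ (1 - c - 1)) x :=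
      HasDerivAt.rpow_const ((hasDerivAt_id x).const_sub 1) (Or.inl hx1.ne')
    have h3 := (hasDerivAt_sol₂ hc hc1 hδ hx).sub (((h1.const_mul (δ / c)).mul h2).mul hd)
    refine h3.congr_deriv ?_
    have e1 : x ^ c = x ^ (c - 1) * x := by
      rw [← Real.rpow_add_one hx.1.ne', sub_add_cancel]
    have e2 : (1 - x) ^ (1 - c) = (1 - x) ^ (-c) * (1 - x) := by
      rw [← Real.rpow_add_one hx1.ne']
      ring_nf
    have e3 : (1 - x) ^ (1 - c - 1) = (1 - x) ^ (-c) := by ring_nf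
    simp only [Pi.mul_apply]
    rw [e1, e2, e3, betaWeight, sub_eq_zero]
    field_simp
    linear_combination (-δ * x ^ (c - 1)) * hode
  -- The endpoint `0` is handled separately: `y^c` is continuous there but not differentiable.
  have hode0 : ContinuousWithinAt (fun y : ℝ => ordinaryHypergeometric (1 + δ) (1 - δ) (c + 1) y)
      (Icc 0 v) 0 := by
    have hb : ∀ k, |hyperCoeff (1 + δ) (1 - δ) (c + 1) k| ≤ 1 := fun k => by
      have h := contiguous_hyperCoeff_nonneg_le_one hc hδ k
      rw [add_comm δ 1, neg_add_eq_sub] at h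
      rw [abs_of_nonneg h.1]
      exact h.2
    have h := (hasDerivAt_tsum_mul_pow hb (x := 0) (by simp)).2.continuousAt
    refine (h.congr (Eventually.of_forall fun y => ?_)).continuousWithinAt
    exact (ordinaryHypergeometric_eq_tsum_mul _ _ _ y).symm
  have hcont : ContinuousOn (fun y : ℝ => sol₂ c δ y - δ / c * y ^ c *
      (1 - y) ^ (1 - c) * ordinaryHypergeometric (1 + δ) (1 - δ) (c + 1) y) (Icc 0 v) := by
    intro y hy
    rcases eq_or_lt_of_le hy.1 with h | h
    · subst h
      refine ContinuousWithinAt.sub (((continuousOn_sol₂ hc hc1 hδ) 0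
        ⟨le_rfl, zero_le_one⟩).mono (Icc_subset_Icc_right hv.2.le)) ?_
      refine ContinuousWithinAt.mul (ContinuousAt.continuousWithinAt ?_) hode0
      refine ContinuousAt.mul (continuousAt_const.mul
        (Real.continuousAt_rpow_const _ _ (Or.inr hc.le))) ?_
      exact ContinuousAt.rpow_const (by fun_prop) (Or.inl (by norm_num))
    · exact (hderiv y ⟨h, hy.2.trans_lt hv.2⟩).continuousAt.continuousWithinAt
  have h := intervalIntegral.integral_eq_sub_of_hasDerivAt_of_le hv.1.le hcont
    (fun x hx => hderiv x ⟨hx.1, hx.2.trans hv.2⟩) intervalIntegrable_const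
  have h0 := h.symm
  simp only [intervalIntegral.integral_zero, sol₂_zero, Real.zero_rpow hc.ne', mul_zero, zero_mul,
    sub_zero] at h0
  exact sub_eq_zero.1 h0

theorem hasDerivAt_sol₁ {c δ v : ℝ} (hc : 0 < c) (hc1 : c < 1) (hδ : |δ| ≤ 1)
    (hv : v ∈ Ioo (0 : ℝ) 1) :
    HasDerivAt (sol₁ c δ) (-δ * (betaWeight (1 - c) v * sol₂ c δ v)) v := by
  refine (hasDerivAt_sol₁_series hc hδ hv).congr_deriv ?_
  have hv1 : 0 < 1 - v := by linarith [hv.2]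
  rw [sol₂_eq hc hc1 hδ hv, betaWeight, show 1 - c - 1 = -c by ring, Real.rpow_neg hv.1.le,
    Real.rpow_neg hv1.le]
  have h1 := (Real.rpow_pos_of_pos hv.1 c).ne'
  have h2 := (Real.rpow_pos_of_pos hv1 (1 - c)).ne'
  field_simp

/-- The conserved quantities determine only the square of `sol₂ c δ 1`; this selects the root. It is
the limit of the positive series form as `v → 1`. -/
theorem sol₂_one_mul_nonneg {c δ : ℝ} (hc : 0 < c) (hc1 : c < 1) (hδ : |δ| ≤ 1) :
    0 ≤ δ * sol₂ c δ 1 := by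
  have hcont : Tendsto (fun v => δ * sol₂ c δ v) (𝓝[<] 1) (𝓝 (δ * sol₂ c δ 1)) := by
    refine Tendsto.const_mul δ (((continuousOn_sol₂ hc hc1 hδ) 1 ⟨zero_le_one, le_rfl⟩).mono_left ?_)
    rw [← nhdsWithin_Ioo_eq_nhdsLT (zero_lt_one (α := ℝ))]
    exact nhdsWithin_mono _ Ioo_subset_Icc_self
  refine ge_of_tendsto hcont ?_
  filter_upwards [Ioo_mem_nhdsLT (zero_lt_one (α := ℝ))] with v hv
  rw [sol₂_eq hc hc1 hδ hv]
  have hF : 0 ≤ ordinaryHypergeometric (1 + δ) (1 - δ) (c + 1) v := by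
    rw [ordinaryHypergeometric_eq_tsum_mul]
    refine tsum_nonneg fun k => mul_nonneg ?_ (pow_nonneg hv.1.le k)
    have h := (contiguous_hyperCoeff_nonneg_le_one hc hδ k).1
    rwa [add_comm δ 1, neg_add_eq_sub] at h
  have h1 := Real.rpow_nonneg hv.1.le c
  have h2 := Real.rpow_nonneg (sub_nonneg.2 hv.2.le) (1 - c)
  calc 0 ≤ δ ^ 2 / c * v ^ c * (1 - v) ^ (1 - c) *
        ordinaryHypergeometric (1 + δ) (1 - δ) (c + 1) v := by positivity
    _ = _ := by ring

/-! ### Conserved quantities and boundary values -/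

theorem eq_of_hasDerivAt_zero_on_unitInterval {g : ℝ → ℝ} (hg : ContinuousOn g (Icc 0 1))
    (hd : ∀ x ∈ Ioo (0 : ℝ) 1, HasDerivAt g 0 x) : g 1 = g 0 := by
  have h := intervalIntegral.integral_eq_sub_of_hasDerivAt_of_le zero_le_one hg hd
    intervalIntegrable_const
  rw [intervalIntegral.integral_zero] at h
  exact sub_eq_zero.1 h.symm

/-- Replacing `c` by `1 - c` swaps the two weights and so gives the adjoint system; the dot product
of the two solutions is constant, with value `1` at `0`. -/
theorem sol₁_mul_add_sol₂_mul_one {c δ : ℝ} (hc : 0 < c) (hc1 : c < 1) (hδ : |δ| ≤ 1) :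
    sol₁ c δ 1 * sol₁ (1 - c) δ 1 + sol₂ c δ 1 * sol₂ (1 - c) δ 1 = 1 := by
  have hc' : 0 < 1 - c := by linarith
  have hc1' : 1 - c < 1 := by linarith
  have h := eq_of_hasDerivAt_zero_on_unitInterval
    (g := fun v => sol₁ c δ v * sol₁ (1 - c) δ v + sol₂ c δ v * sol₂ (1 - c) δ v)
    (((continuousOn_sol₁ hc hδ).mul (continuousOn_sol₁ hc' hδ)).add
      ((continuousOn_sol₂ hc hc1 hδ).mul (continuousOn_sol₂ hc' hc1' hδ)))
    (fun x hx => by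
      refine (((hasDerivAt_sol₁ hc hc1 hδ hx).mul (hasDerivAt_sol₁ hc' hc1' hδ hx)).add
        ((hasDerivAt_sol₂ hc hc1 hδ hx).mul (hasDerivAt_sol₂ hc' hc1' hδ hx))).congr_deriv ?_
      rw [sub_sub_cancel]
      ring)
  simpa [sol₁_zero, sol₂_zero] using h

/-- The weight for `1 - c` at `1 - v` is the weight for `c` at `v`, so the solution for `1 - c` read
backwards pairs with the one for `c` to a constant; its values at `0` and `1` are the two sides. -/
theorem sol₂_one_one_sub {c δ : ℝ} (hc : 0 < c) (hc1 : c < 1) (hδ : |δ| ≤ 1) :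
    sol₂ (1 - c) δ 1 = sol₂ c δ 1 := by
  have hc' : 0 < 1 - c := by linarith
  have hc1' : 1 - c < 1 := by linarith
  have hsub : ContinuousOn (fun v : ℝ => 1 - v) (Icc 0 1) := by fun_prop
  have hmaps : MapsTo (fun v : ℝ => 1 - v) (Icc 0 1) (Icc 0 1) :=
    fun v hv => ⟨by linarith [hv.2], by linarith [hv.1]⟩
  have h := eq_of_hasDerivAt_zero_on_unitInterval
    (g := fun v => sol₁ c δ v * sol₂ (1 - c) δ (1 - v) + sol₂ c δ v * sol₁ (1 - c) δ (1 - v))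
    (((continuousOn_sol₁ hc hδ).mul ((continuousOn_sol₂ hc' hc1' hδ).comp hsub hmaps)).add
      ((continuousOn_sol₂ hc hc1 hδ).mul ((continuousOn_sol₁ hc' hδ).comp hsub hmaps)))
    (fun x hx => by
      have hx' : 1 - x ∈ Ioo (0 : ℝ) 1 := ⟨by linarith [hx.2], by linarith [hx.1]⟩
      have hs : HasDerivAt (fun v : ℝ => 1 - v) (-1) x := (hasDerivAt_id x).const_sub 1
      have h1 := (hasDerivAt_sol₁ hc' hc1' hδ hx').comp x hs
      have h2 := (hasDerivAt_sol₂ hc' hc1' hδ hx').comp x hs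
      refine (((hasDerivAt_sol₁ hc hc1 hδ hx).mul h2).add
        ((hasDerivAt_sol₂ hc hc1 hδ hx).mul h1)).congr_deriv ?_
      have e : betaWeight c (1 - x) = betaWeight (1 - c) x := by
        rw [← betaWeight_one_sub c, sub_sub_cancel]
      simp only [Function.comp]
      rw [sub_sub_cancel, e, betaWeight_one_sub]
      ring)
  simpa [sol₁_zero, sol₂_zero] using h.symm

theorem sol₁_one {c δ : ℝ} (hc : 0 < c) (hδ : |δ| < 1) :
    sol₁ c δ 1 = Real.Gamma c ^ 2 / (Real.Gamma (c + δ) * Real.Gamma (c - δ)) :=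
  ordinaryHypergeometric_one hc hδ

theorem sol₁_one_mul {c δ : ℝ} (hc : 0 < c) (hc1 : c < 1) (hδ : |δ| < 1) :
    sol₁ c δ 1 * sol₁ (1 - c) δ 1 =
      1 - (Real.sin (Real.pi * δ) / Real.sin (Real.pi * c)) ^ 2 := by
  have hs : Real.sin (Real.pi * c) ≠ 0 :=
    (Real.sin_pos_of_pos_of_lt_pi (by positivity) (by nlinarith [Real.pi_pos])).ne'
  have h0 := Real.Gamma_mul_Gamma_one_sub c
  have hp := Real.Gamma_mul_Gamma_one_sub (c + δ)
  have hm := Real.Gamma_mul_Gamma_one_sub (c - δ)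
  rw [sol₁_one hc hδ, sol₁_one (by linarith) hδ]
  rw [show 1 - (c + δ) = 1 - c - δ by ring] at hp
  rw [show 1 - (c - δ) = 1 - c + δ by ring] at hm
  have e : Real.Gamma c ^ 2 / (Real.Gamma (c + δ) * Real.Gamma (c - δ)) *
      (Real.Gamma (1 - c) ^ 2 / (Real.Gamma (1 - c + δ) * Real.Gamma (1 - c - δ))) =
      (Real.Gamma c * Real.Gamma (1 - c)) ^ 2 / ((Real.Gamma (c + δ) * Real.Gamma (1 - c - δ)) *
        (Real.Gamma (c - δ) * Real.Gamma (1 - c + δ))) := by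
    rw [div_mul_div_comm]
    congr 1 <;> ring
  have hsin : Real.sin (Real.pi * (c + δ)) * Real.sin (Real.pi * (c - δ)) =
      Real.sin (Real.pi * c) ^ 2 - Real.sin (Real.pi * δ) ^ 2 := by
    rw [mul_add, mul_sub, Real.sin_add, Real.sin_sub]
    linear_combination Real.sin (Real.pi * c) ^ 2 * Real.sin_sq_add_cos_sq (Real.pi * δ) -
      Real.sin (Real.pi * δ) ^ 2 * Real.sin_sq_add_cos_sq (Real.pi * c)
  -- No case split at poles is needed: there the reflection formula reads `0 = π / 0`.
  rw [e, h0, hp, hm]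
  have hpi := Real.pi_ne_zero
  calc _ = Real.sin (Real.pi * (c + δ)) * Real.sin (Real.pi * (c - δ)) /
        Real.sin (Real.pi * c) ^ 2 := by
        rw [div_mul_div_comm, div_pow, div_div_div_eq, ← pow_two Real.pi,
          mul_comm (Real.sin (Real.pi * c) ^ 2), mul_div_mul_left _ _ (pow_ne_zero 2 hpi)]
    _ = _ := by
        rw [hsin]
        field_simp

theorem sol₂_one {c δ : ℝ} (hc : 0 < c) (hc1 : c < 1) (hδ : |δ| < 1) :
    sol₂ c δ 1 = Real.sin (Real.pi * δ) / Real.sin (Real.pi * c) := by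
  have hs : 0 < Real.sin (Real.pi * c) :=
    Real.sin_pos_of_pos_of_lt_pi (by positivity) (by nlinarith [Real.pi_pos])
  have h1 := sol₁_mul_add_sol₂_mul_one hc hc1 hδ.le
  rw [sol₁_one_mul hc hc1 hδ, sol₂_one_one_sub hc hc1 hδ.le] at h1
  have h2 : sol₂ c δ 1 ^ 2 = (Real.sin (Real.pi * δ) / Real.sin (Real.pi * c)) ^ 2 := by
    linear_combination h1
  have hsgn := sol₂_one_mul_nonneg hc hc1 hδ.le
  obtain ⟨hδ₁, hδ₂⟩ := abs_lt.1 hδ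
  have hpi := Real.pi_pos
  rcases lt_trichotomy δ 0 with h | h | h
  · have h3 : Real.sin (Real.pi * δ) / Real.sin (Real.pi * c) ≤ 0 :=
      div_nonpos_of_nonpos_of_nonneg
        (Real.sin_nonpos_of_nonpos_of_neg_pi_le (by nlinarith) (by nlinarith)) hs.le
    have h4 : sol₂ c δ 1 ≤ 0 := by
      by_contra! hcon
      nlinarith
    have := (pow_left_inj₀ (neg_nonneg.2 h4) (neg_nonneg.2 h3) two_ne_zero).1
      (by rw [neg_sq, neg_sq, h2])
    linarith
  · subst h
    simp [sol₂]
  · have h3 : 0 ≤ Real.sin (Real.pi * δ) / Real.sin (Real.pi * c) :=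
      div_nonneg (Real.sin_nonneg_of_nonneg_of_le_pi (by positivity) (by nlinarith)) hs.le
    have h4 : 0 ≤ sol₂ c δ 1 := nonneg_of_mul_nonneg_right hsgn h
    exact (pow_left_inj₀ h4 h3 two_ne_zero).1 h2

/-! ### The normalizing integral -/

/-- The density `w(c) u₁ u₁' + w(1-c) u₂ u₂'` of two solutions with parameters `δ`, `δ'`. -/
noncomputable def pairing (c δ δ' v : ℝ) : ℝ :=
  betaWeight c v * (sol₁ c δ v * sol₁ c δ' v) + betaWeight (1 - c) v * (sol₂ c δ v * sol₂ c δ' v)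

theorem intervalIntegrable_pairing {c δ δ' : ℝ} (hc : 0 < c) (hc1 : c < 1) (hδ : |δ| ≤ 1)
    (hδ' : |δ'| ≤ 1) : IntervalIntegrable (pairing c δ δ') volume 0 1 :=
  (intervalIntegrable_betaWeight_mul hc hc1
    ((continuousOn_sol₁ hc hδ).mul (continuousOn_sol₁ hc hδ'))).add
  (intervalIntegrable_betaWeight_mul (by linarith) (by linarith)
    ((continuousOn_sol₂ hc hc1 hδ).mul (continuousOn_sol₂ hc hc1 hδ')))

/-- Lagrange's identity for the system: the boundary expression is the Wronskian of the solutions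
with parameters `δ`, `δ'`, which vanishes at `0`. -/
theorem sub_mul_integral_pairing {c δ δ' : ℝ} (hc : 0 < c) (hc1 : c < 1) (hδ : |δ| ≤ 1)
    (hδ' : |δ'| ≤ 1) :
    (δ' - δ) * ∫ v in (0 : ℝ)..1, pairing c δ δ' v =
      sol₁ c δ 1 * sol₂ c δ' 1 - sol₂ c δ 1 * sol₁ c δ' 1 := by
  rw [← intervalIntegral.integral_const_mul]
  have h := intervalIntegral.integral_eq_sub_of_hasDerivAt_of_le zero_le_one
    (f := fun v => sol₁ c δ v * sol₂ c δ' v - sol₂ c δ v * sol₁ c δ' v)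
    (f' := fun v => (δ' - δ) * pairing c δ δ' v)
    (((continuousOn_sol₁ hc hδ).mul (continuousOn_sol₂ hc hc1 hδ')).sub
      ((continuousOn_sol₂ hc hc1 hδ).mul (continuousOn_sol₁ hc hδ')))
    (fun x hx => by
      refine (((hasDerivAt_sol₁ hc hc1 hδ hx).mul (hasDerivAt_sol₂ hc hc1 hδ' hx)).sub
        ((hasDerivAt_sol₂ hc hc1 hδ hx).mul (hasDerivAt_sol₁ hc hc1 hδ' hx))).congr_deriv ?_
      rw [pairing]
      ring)
    ((intervalIntegrable_pairing hc hc1 hδ hδ').const_mul _)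
  rw [h]
  simp [sol₂_zero]

theorem abs_sol₂_le {c δ v : ℝ} (hc : 0 < c) (hc1 : c < 1) (hδ : |δ| ≤ 1)
    (hv : v ∈ Icc (0 : ℝ) 1) :
    |sol₂ c δ v| ≤ solBound c * ∫ t in (0 : ℝ)..1, betaWeight c t := by
  have hB : 0 ≤ solBound c := (abs_nonneg _).trans (abs_sol₁_le hc hδ hv)
  have hi := intervalIntegrable_betaWeight hc hc1
  have hi' : IntervalIntegrable (fun t => solBound c * betaWeight c t) volume 0 v := by
    refine (hi.mono_set ?_).const_mul _
    rw [uIcc_of_le zero_le_one, uIcc_of_le hv.1]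
    exact Icc_subset_Icc_right hv.2
  rw [sol₂, abs_mul]
  calc _ ≤ 1 * |∫ t in (0 : ℝ)..v, betaWeight c t * sol₁ c δ t| := by gcongr
    _ ≤ ∫ t in (0 : ℝ)..v, solBound c * betaWeight c t := by
      rw [one_mul, ← Real.norm_eq_abs]
      refine intervalIntegral.norm_integral_le_of_norm_le (E := ℝ) hv.1 (ae_of_all _ fun t ht => ?_) hi'
      have ht' : t ∈ Icc (0 : ℝ) 1 := ⟨ht.1.le, ht.2.trans hv.2⟩
      rw [Real.norm_eq_abs, abs_mul, abs_of_nonneg (betaWeight_nonneg ht'), mul_comm]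
      exact mul_le_mul_of_nonneg_right (abs_sol₁_le hc hδ ht') (betaWeight_nonneg ht')
    _ ≤ ∫ t in (0 : ℝ)..1, solBound c * betaWeight c t := by
      refine intervalIntegral.integral_mono_interval le_rfl hv.1 hv.2 ?_ (hi.const_mul _)
      refine (ae_restrict_iff' measurableSet_Ioc).2 (ae_of_all _ fun t ht => ?_)
      exact mul_nonneg hB (betaWeight_nonneg ⟨ht.1.le, ht.2⟩)
    _ = _ := intervalIntegral.integral_const_mul _ _

theorem eventually_abs_le_one {δ : ℝ} (hδ : |δ| < 1) : ∀ᶠ δ' in 𝓝 δ, |δ'| ≤ 1 :=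
  (continuous_abs.continuousAt.eventually (gt_mem_nhds hδ)).mono fun _ h => h.le

theorem tendsto_sol₁_param {c δ v : ℝ} (hc : 0 < c) (hδ : |δ| < 1) (hv : v ∈ Icc (0 : ℝ) 1) :
    Tendsto (fun δ' => sol₁ c δ' v) (𝓝 δ) (𝓝 (sol₁ c δ v)) :=
  (continuousOn_sol₁_param hc hv).continuousAt (eventually_abs_le_one hδ)

theorem tendsto_sol₂_param {c δ v : ℝ} (hc : 0 < c) (hc1 : c < 1) (hδ : |δ| < 1)
    (hv : v ∈ Icc (0 : ℝ) 1) :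
    Tendsto (fun δ' => sol₂ c δ' v) (𝓝 δ) (𝓝 (sol₂ c δ v)) := by
  have hsub : ∀ {t}, t ∈ uIoc 0 v → t ∈ Icc (0 : ℝ) 1 := fun {t} ht => by
    rw [uIoc_of_le hv.1] at ht
    exact ⟨ht.1.le, ht.2.trans hv.2⟩
  have hset : uIcc 0 v ⊆ uIcc (0 : ℝ) 1 := by
    rw [uIcc_of_le zero_le_one, uIcc_of_le hv.1]
    exact Icc_subset_Icc_right hv.2
  refine tendsto_id.mul (intervalIntegral.tendsto_integral_filter_of_dominated_convergence
    (fun t => betaWeight c t * solBound c) ?_ ?_ ?_ ?_)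
  · filter_upwards [eventually_abs_le_one hδ] with δ' h'
    exact ((intervalIntegrable_betaWeight_mul hc hc1
      (continuousOn_sol₁ hc h')).mono_set hset).aestronglyMeasurable_restrict_uIoc
  · filter_upwards [eventually_abs_le_one hδ] with δ' h'
    refine ae_of_all _ fun t ht => ?_
    rw [Real.norm_eq_abs, abs_mul, abs_of_nonneg (betaWeight_nonneg (hsub ht))]
    exact mul_le_mul_of_nonneg_left (abs_sol₁_le hc h' (hsub ht)) (betaWeight_nonneg (hsub ht))
  · exact ((intervalIntegrable_betaWeight hc hc1).mono_set hset).mul_const _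
  · exact ae_of_all _ fun t ht => (tendsto_sol₁_param hc hδ (hsub ht)).const_mul _

theorem tendsto_integral_pairing {c δ : ℝ} (hc : 0 < c) (hc1 : c < 1) (hδ : |δ| < 1) :
    Tendsto (fun δ' => ∫ v in (0 : ℝ)..1, pairing c δ δ' v) (𝓝 δ)
      (𝓝 (∫ v in (0 : ℝ)..1, pairing c δ δ v)) := by
  set B := solBound c with hB
  set D := solBound c * ∫ t in (0 : ℝ)..1, betaWeight c t with hD
  have hsub : ∀ {t}, t ∈ uIoc 0 1 → t ∈ Icc (0 : ℝ) 1 := fun {t} ht => by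
    rw [uIoc_of_le zero_le_one] at ht
    exact ⟨ht.1.le, ht.2⟩
  refine intervalIntegral.tendsto_integral_filter_of_dominated_convergence
    (fun t => betaWeight c t * (B * B) + betaWeight (1 - c) t * (D * D)) ?_ ?_ ?_ ?_
  · filter_upwards [eventually_abs_le_one hδ] with δ' h'
    exact (intervalIntegrable_pairing hc hc1 hδ.le h').aestronglyMeasurable_restrict_uIoc
  · filter_upwards [eventually_abs_le_one hδ] with δ' h'
    refine ae_of_all _ fun t ht => ?_
    have ht' := hsub ht
    have b1 := abs_sol₁_le hc hδ.le ht'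
    have b2 := abs_sol₁_le hc h' ht'
    have b3 := abs_sol₂_le hc hc1 hδ.le ht'
    have b4 := abs_sol₂_le hc hc1 h' ht'
    have hw := betaWeight_nonneg (c := c) ht'
    have hw' := betaWeight_nonneg (c := 1 - c) ht'
    have hB0 : 0 ≤ B := (abs_nonneg _).trans b1
    have hD0 : 0 ≤ D := (abs_nonneg _).trans b3
    rw [pairing, Real.norm_eq_abs]
    refine (abs_add_le _ _).trans ?_
    rw [abs_mul, abs_mul, abs_mul, abs_mul, abs_of_nonneg hw, abs_of_nonneg hw']
    gcongr
  · exact ((intervalIntegrable_betaWeight hc hc1).mul_const _).add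
      ((intervalIntegrable_betaWeight (by linarith) (by linarith)).mul_const _)
  · refine ae_of_all _ fun t ht => ?_
    have ht' := hsub ht
    exact ((tendsto_const_nhds.mul (tendsto_sol₁_param hc hδ ht')).const_mul _).add
      ((tendsto_const_nhds.mul (tendsto_sol₂_param hc hc1 hδ ht')).const_mul _)

/-- Letting `δ' → δ` directly in Lagrange's identity would need the derivatives of `a` and `a'` in
`δ`. Averaging the coefficients over the two parameters makes their difference quotients cancel, so
only `b` is differentiated and continuity of `a`, `a'` suffices. -/
theorem integral_pairing_combination {c δ : ℝ} (hc : 0 < c) (hc1 : c < 1) (hδ : |δ| < 1) :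
    sol₁ (1 - c) δ 1 * (∫ v in (0 : ℝ)..1, pairing c δ δ v) +
      sol₁ c δ 1 * (∫ v in (0 : ℝ)..1, pairing (1 - c) δ δ v) =
      2 * Real.pi * (Real.cos (Real.pi * δ) / Real.sin (Real.pi * c)) := by
  have hc' : 0 < 1 - c := by linarith
  have hc1' : 1 - c < 1 := by linarith
  have hv1 : (1 : ℝ) ∈ Icc (0 : ℝ) 1 := ⟨zero_le_one, le_rfl⟩
  set b : ℝ → ℝ := fun x => Real.sin (Real.pi * x) / Real.sin (Real.pi * c) with hb
  have hbd : HasDerivAt b (Real.pi * (Real.cos (Real.pi * δ) / Real.sin (Real.pi * c))) δ := by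
    have h := (((hasDerivAt_id δ).const_mul Real.pi).sin).div_const (Real.sin (Real.pi * c))
    refine h.congr_deriv ?_
    simp only [id]
    ring
  have hbt : Tendsto b (𝓝 δ) (𝓝 (b δ)) := hbd.continuousAt
  have hJ := tendsto_integral_pairing hc hc1 hδ
  have hJ' := tendsto_integral_pairing hc' hc1' hδ
  have ha := tendsto_sol₁_param hc hδ hv1
  have ha' := tendsto_sol₁_param hc' hδ hv1
  set a : ℝ → ℝ := fun x => sol₁ c x 1
  set a' : ℝ → ℝ := fun x => sol₁ (1 - c) x 1
  set J : ℝ → ℝ := fun x => ∫ v in (0 : ℝ)..1, pairing c δ x v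
  set J' : ℝ → ℝ := fun x => ∫ v in (0 : ℝ)..1, pairing (1 - c) δ x v
  have hL : Tendsto (fun x => (a' δ + a' x) / 2 * J x + (a δ + a x) / 2 * J' x) (𝓝 δ)
      (𝓝 ((a' δ + a' δ) / 2 * J δ + (a δ + a δ) / 2 * J' δ)) :=
    ((((tendsto_const_nhds.add ha').div_const 2).mul hJ).add
      (((tendsto_const_nhds.add ha).div_const 2).mul hJ'))
  have hR : Tendsto (fun x => slope b δ x * (1 + b δ * b x + (a δ * a' x + a x * a' δ) / 2))
      (𝓝[≠] δ) (𝓝 (Real.pi * (Real.cos (Real.pi * δ) / Real.sin (Real.pi * c)) *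
        (1 + b δ * b δ + (a δ * a' δ + a δ * a' δ) / 2))) := by
    refine (hasDerivAt_iff_tendsto_slope.1 hbd).mul (Tendsto.mono_left ?_ nhdsWithin_le_nhds)
    exact (tendsto_const_nhds.add (tendsto_const_nhds.mul hbt)).add
      (((tendsto_const_nhds.mul ha').add (ha.mul tendsto_const_nhds)).div_const 2)
  have hrel : ∀ x, |x| < 1 → a x * a' x = 1 - b x ^ 2 := fun x hx => sol₁_one_mul hc hc1 hx
  have hEq : (fun x => slope b δ x * (1 + b δ * b x + (a δ * a' x + a x * a' δ) / 2)) =ᶠ[𝓝[≠] δ]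
      fun x => (a' δ + a' x) / 2 * J x + (a δ + a x) / 2 * J' x := by
    have hev : ∀ᶠ x in 𝓝[≠] δ, |x| < 1 :=
      nhdsWithin_le_nhds (continuous_abs.continuousAt.eventually (gt_mem_nhds hδ))
    filter_upwards [hev, self_mem_nhdsWithin] with x hx hne
    have hne' : x - δ ≠ 0 := sub_ne_zero.2 hne
    have h1 : (x - δ) * J x = a δ * b x - b δ * a x := by
      have h := sub_mul_integral_pairing hc hc1 hδ.le hx.le
      rwa [sol₂_one hc hc1 hδ, sol₂_one hc hc1 hx] at h
    have h2 : (x - δ) * J' x = a' δ * b x - b δ * a' x := by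
      have h := sub_mul_integral_pairing hc' hc1' hδ.le hx.le
      rwa [sol₂_one_one_sub hc hc1 hδ.le, sol₂_one_one_sub hc hc1 hx.le, sol₂_one hc hc1 hδ,
        sol₂_one hc hc1 hx] at h
    have hs : (x - δ) * slope b δ x = b x - b δ := by
      rw [slope_def_field]
      field_simp
    refine mul_left_cancel₀ hne' ?_
    -- After `h1` and `h2`, the diagonal products `a a'` at `δ` and at `x` become `1 - b²`; what
    -- remains factors through `b x - b δ`.
    linear_combination (1 + b δ * b x + (a δ * a' x + a x * a' δ) / 2) * hs -
      (a' δ + a' x) / 2 * h1 - (a δ + a x) / 2 * h2 - b x * hrel δ hδ + b δ * hrel x hx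
  have h := tendsto_nhds_unique (hR.congr' hEq) (hL.mono_left nhdsWithin_le_nhds)
  linear_combination -h +
    Real.pi * (Real.cos (Real.pi * δ) / Real.sin (Real.pi * c)) * hrel δ hδ

theorem f₁_sq_add_f₂_sq {κ δ v : ℝ} (hκ : -(1 / 2) < κ) (hκ' : κ < 1 / 2) (hδ : |δ| ≤ 1)
    (hv : v ∈ Ioo (0 : ℝ) 1) :
    (f₁ κ δ v ^ 2 + f₂ κ δ v ^ 2) * (v * (1 - v)) ^ (-(1 / 2) : ℝ) =
      pairing (1 / 2 + κ) δ δ v := by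
  have hc : 0 < 1 / 2 + κ := by linarith
  have hv0 := hv.1
  have hv1 : 0 < 1 - v := by linarith [hv.2]
  have e1 : ordinaryHypergeometric δ (-δ) (1 / 2 + κ) v = sol₁ (1 / 2 + κ) δ v := rfl
  have e2 := sol₂_eq hc (by linarith) hδ hv
  rw [show 1 / 2 + κ + 1 = 3 / 2 + κ by ring] at e2
  rw [pairing, e2, f₁, f₂, e1, Real.mul_rpow hv0.le hv1.le, betaWeight, betaWeight]
  set A := sol₁ (1 / 2 + κ) δ v
  set B := ordinaryHypergeometric (1 + δ) (1 - δ) (3 / 2 + κ) v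
  set s := δ / (1 / 2 + κ)
  have r1 : (v ^ (κ / 2)) ^ 2 * v ^ (-(1 / 2) : ℝ) = v ^ (1 / 2 + κ - 1) := by
    rw [← Real.rpow_natCast, ← Real.rpow_mul hv0.le, ← Real.rpow_add hv0]
    congr 1
    push_cast
    ring
  have r2 : ((1 - v) ^ (-κ / 2)) ^ 2 * (1 - v) ^ (-(1 / 2) : ℝ) = (1 - v) ^ (-(1 / 2 + κ)) := by
    rw [← Real.rpow_natCast, ← Real.rpow_mul hv1.le, ← Real.rpow_add hv1]
    congr 1
    push_cast
    ring
  have r3 : (v ^ ((κ + 1) / 2)) ^ 2 * v ^ (-(1 / 2) : ℝ) =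
      v ^ (1 - (1 / 2 + κ) - 1) * (v ^ (1 / 2 + κ)) ^ 2 := by
    rw [← Real.rpow_natCast, ← Real.rpow_natCast, ← Real.rpow_mul hv0.le, ← Real.rpow_mul hv0.le,
      ← Real.rpow_add hv0, ← Real.rpow_add hv0]
    congr 1
    push_cast
    ring
  have r4 : ((1 - v) ^ ((1 - κ) / 2)) ^ 2 * (1 - v) ^ (-(1 / 2) : ℝ) =
      (1 - v) ^ (-(1 - (1 / 2 + κ))) * ((1 - v) ^ (1 - (1 / 2 + κ))) ^ 2 := by
    rw [← Real.rpow_natCast, ← Real.rpow_natCast, ← Real.rpow_mul hv1.le, ← Real.rpow_mul hv1.le,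
      ← Real.rpow_add hv1, ← Real.rpow_add hv1]
    congr 1
    push_cast
    ring
  calc _ = ((v ^ (κ / 2)) ^ 2 * v ^ (-(1 / 2) : ℝ)) *
        (((1 - v) ^ (-κ / 2)) ^ 2 * (1 - v) ^ (-(1 / 2) : ℝ)) * (A * A) +
      ((v ^ ((κ + 1) / 2)) ^ 2 * v ^ (-(1 / 2) : ℝ)) *
        (((1 - v) ^ ((1 - κ) / 2)) ^ 2 * (1 - v) ^ (-(1 / 2) : ℝ)) * (s ^ 2 * B ^ 2) := by ring
    _ = _ := by
      rw [r1, r2, r3, r4]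
      ring

theorem H_eq_sol₁_one {κ δ : ℝ} (hκ : -(1 / 2) < κ) (hδ : |δ| < 1) :
    H κ δ = sol₁ (1 / 2 + κ) δ 1 :=
  (sol₁_one (by linarith) hδ).symm

theorem G₁_mul_eq {κ δ v : ℝ} (hκ : -(1 / 2) < κ) (hκ' : κ < 1 / 2) (hδ : |δ| < 1)
    (hv : v ∈ Ioo (0 : ℝ) 1) :
    G₁ κ δ v * (v * (1 - v)) ^ (-(1 / 2) : ℝ) =
      sol₁ (1 - (1 / 2 + κ)) δ 1 * pairing (1 / 2 + κ) δ δ v +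
        sol₁ (1 / 2 + κ) δ 1 * pairing (1 - (1 / 2 + κ)) δ δ v := by
  have h1 := f₁_sq_add_f₂_sq hκ hκ' hδ.le hv
  have h2 := f₁_sq_add_f₂_sq (κ := -κ) (by linarith) (by linarith) hδ.le hv
  rw [show 1 - (1 / 2 + κ) = 1 / 2 + -κ by ring, ← h1, ← h2, ← H_eq_sol₁_one hκ hδ,
    ← H_eq_sol₁_one (by linarith) hδ, G₁]
  ring

theorem intervalIntegrable_G₁_and_integral_G₁ {κ δ : ℝ} (hκ : -(1 / 2) < κ) (hκ' : κ < 1 / 2)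
    (hδ : |δ| < 1) :
    IntervalIntegrable (fun v : ℝ => G₁ κ δ v * (v * (1 - v)) ^ (-(1 / 2) : ℝ)) volume 0 1 ∧
      ∫ v in (0 : ℝ)..1, G₁ κ δ v * (v * (1 - v)) ^ (-(1 / 2) : ℝ) =
        2 * Real.pi * (Real.cos (δ * Real.pi) / Real.cos (κ * Real.pi)) := by
  have hc : 0 < 1 / 2 + κ := by linarith
  have hc1 : 1 / 2 + κ < 1 := by linarith
  have hi := (intervalIntegrable_pairing hc hc1 hδ.le hδ.le).const_mul
    (sol₁ (1 - (1 / 2 + κ)) δ 1)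
  have hi' := (intervalIntegrable_pairing (c := 1 - (1 / 2 + κ)) (by linarith) (by linarith)
    hδ.le hδ.le).const_mul (sol₁ (1 / 2 + κ) δ 1)
  have hae : ∀ᵐ v ∂volume, v ∈ uIoc (0 : ℝ) 1 →
      sol₁ (1 - (1 / 2 + κ)) δ 1 * pairing (1 / 2 + κ) δ δ v +
        sol₁ (1 / 2 + κ) δ 1 * pairing (1 - (1 / 2 + κ)) δ δ v =
      G₁ κ δ v * (v * (1 - v)) ^ (-(1 / 2) : ℝ) := by
    -- The pointwise identity is available only on the open interval, so the endpoint `1` is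
    -- discarded as a null set.
    filter_upwards [Measure.ae_ne volume (1 : ℝ)] with v hne hv
    rw [uIoc_of_le zero_le_one] at hv
    exact (G₁_mul_eq hκ hκ' hδ ⟨hv.1, lt_of_le_of_ne hv.2 hne⟩).symm
  refine ⟨(hi.add hi').congr_ae ((ae_restrict_iff' measurableSet_uIoc).2 hae), ?_⟩
  rw [← intervalIntegral.integral_congr_ae hae, intervalIntegral.integral_add hi hi',
    intervalIntegral.integral_const_mul, intervalIntegral.integral_const_mul,
    integral_pairing_combination hc hc1 hδ, mul_comm δ, mul_comm κ, mul_add,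
    show Real.pi * (1 / 2) + Real.pi * κ = Real.pi * κ + Real.pi / 2 by ring, Real.sin_add_pi_div_two]

/-! ### Traces of the matrix weights -/

theorem chamberWeight_trace (c κ δ φ : ℝ) :
    chamberWeight c κ δ φ 0 0 + chamberWeight c κ δ φ 1 1 =
      c * G₁ κ δ (Real.sin (φ / 2) ^ 2) := by
  simp only [chamberWeight, L, G₁, Matrix.smul_apply, Matrix.mul_apply, Fin.sum_univ_two,
    Matrix.transpose_apply, Matrix.of_apply, Matrix.cons_val', Matrix.cons_val_zero,
    Matrix.cons_val_one, Matrix.cons_val_fin_one, smul_eq_mul]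
  generalize f₁ κ δ (Real.sin (φ / 2) ^ 2) = a
  generalize f₂ κ δ (Real.sin (φ / 2) ^ 2) = b
  generalize f₁ (-κ) δ (Real.sin (φ / 2) ^ 2) = a'
  generalize f₂ (-κ) δ (Real.sin (φ / 2) ^ 2) = b'
  linear_combination (c * ((a ^ 2 + b ^ 2) * H (-κ) δ + (a' ^ 2 + b' ^ 2) * H κ δ)) *
    Real.sin_sq_add_cos_sq (δ * φ)

theorem chamberWeight_isSymm (c κ δ φ : ℝ) : (chamberWeight c κ δ φ).IsSymm := by
  have h : (!![H (-κ) δ, 0; 0, H κ δ] : Matrix (Fin 2) (Fin 2) ℝ).transpose =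
      !![H (-κ) δ, 0; 0, H κ δ] := by
    ext i j
    fin_cases i <;> fin_cases j <;> rfl
  rw [Matrix.IsSymm, chamberWeight, Matrix.transpose_smul, Matrix.transpose_mul,
    Matrix.transpose_mul, Matrix.transpose_transpose, h, Matrix.mul_assoc]

/-- `B* B = 2`, hence the factor `2`. -/
theorem toComplexBasis_trace (K : Matrix (Fin 2) (Fin 2) ℝ) :
    toComplexBasis K 0 0 + toComplexBasis K 1 1 = ((2 * (K 0 0 + K 1 1) : ℝ) : ℂ) := by
  simp [toComplexBasis, Matrix.mul_apply, Matrix.vecMul, dotProduct, Fin.sum_univ_two]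
  linear_combination (-2 * (K 1 1 : ℂ)) * Complex.I_mul_I

/-- The off-diagonal entries enter only through `i (K₁₀ - K₀₁)`, which symmetry kills. -/
theorem toComplexBasis_zero_zero {K : Matrix (Fin 2) (Fin 2) ℝ} (hK : K.IsSymm) :
    toComplexBasis K 0 0 = ((K.trace : ℝ) : ℂ) := by
  have h : K 1 0 = K 0 1 := hK.apply 0 1
  simp [toComplexBasis, Matrix.mul_apply, Matrix.vecMul, dotProduct, Fin.sum_univ_two,
    Matrix.trace_fin_two, h]
  linear_combination (-(K 1 1 : ℂ)) * Complex.I_mul_I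

theorem isSymm_and_trace_conj {K Q : Matrix (Fin 2) (Fin 2) ℝ} (hK : K.IsSymm)
    (hQ : Q.transpose * Q = 1) :
    (Q⁻¹ * K * Q).IsSymm ∧ (Q⁻¹ * K * Q).trace = K.trace := by
  rw [Matrix.inv_eq_left_inv hQ]
  constructor
  · rw [Matrix.IsSymm, Matrix.transpose_mul, Matrix.transpose_mul, Matrix.transpose_transpose,
      hK.eq, Matrix.mul_assoc]
  · rw [Matrix.trace_mul_cycle, mul_eq_one_comm.1 hQ, Matrix.one_mul]

theorem tauReflection_orthogonal (m ℓ : ℕ) (j : ℤ) :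
    (tauReflection m ℓ j).transpose * tauReflection m ℓ j = 1 := by
  simp only [tauReflection]
  generalize 2 * Real.pi * ℓ * j / m = α
  have h := Real.sin_sq_add_cos_sq α
  ext i k
  fin_cases i <;> fin_cases k <;> simp [Matrix.mul_apply, Fin.sum_univ_two] <;> linarith

theorem tauRotation_orthogonal (m ℓ : ℕ) (j : ℤ) :
    (tauRotation m ℓ j).transpose * tauRotation m ℓ j = 1 := by
  simp only [tauRotation]
  generalize 2 * Real.pi * ℓ * j / m = α
  have h := Real.sin_sq_add_cos_sq α
  ext i k
  fin_cases i <;> fin_cases k <;> simp [Matrix.mul_apply, Fin.sum_univ_two] <;> linarith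

theorem chamberWeight_trace' (c κ δ φ : ℝ) :
    (chamberWeight c κ δ φ).trace = c * G₁ κ δ (Real.sin (φ / 2) ^ 2) := by
  rw [Matrix.trace_fin_two, chamberWeight_trace]

theorem sin_sub_int_mul_pi_sq (x : ℝ) (j : ℤ) :
    Real.sin (x - j * Real.pi) ^ 2 = Real.sin x ^ 2 := by
  rw [Real.sin_sub_int_mul_pi, mul_pow, ← sq_abs ((-1 : ℝ) ^ j), abs_neg_one_zpow, one_pow, one_mul]

/-- Conjugation by the orthogonal matrices of `τ_ℓ` preserves symmetry and trace, and moving to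
another chamber changes `mθ/2` by a multiple of `π` and possibly a sign, neither of which affects
`sin²`. -/
theorem planeWeight_isSymm_and_trace {m : ℕ} (hm : m ≠ 0) (ℓ : ℕ) (c κ : ℝ) (z : ℂ) :
    (planeWeight m ℓ c κ z).IsSymm ∧ (planeWeight m ℓ c κ z).trace =
      c * G₁ κ (1 / 2 - ℓ / m) (Real.sin (m * z.arg / 2) ^ 2) := by
  have hm' : (m : ℝ) ≠ 0 := Nat.cast_ne_zero.2 hm
  simp only [planeWeight]
  split_ifs with h
  · obtain ⟨h1, h2⟩ := isSymm_and_trace_conj (chamberWeight_isSymm c κ (1 / 2 - ℓ / m)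
      (m * (z.arg - 2 * Real.pi * ⌊m * z.arg / (2 * Real.pi)⌋ / m)))
      (tauRotation_orthogonal m ℓ ⌊m * z.arg / (2 * Real.pi)⌋)
    refine ⟨h1, h2.trans ?_⟩
    rw [chamberWeight_trace', ← sin_sub_int_mul_pi_sq (m * z.arg / 2)
      ⌊m * z.arg / (2 * Real.pi)⌋]
    congr 4
    field_simp
  · obtain ⟨h1, h2⟩ := isSymm_and_trace_conj (chamberWeight_isSymm c κ (1 / 2 - ℓ / m)
      (m * (2 * Real.pi / m - (z.arg - 2 * Real.pi * ⌊m * z.arg / (2 * Real.pi)⌋ / m))))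
      (tauReflection_orthogonal m ℓ (⌊m * z.arg / (2 * Real.pi)⌋ + 1))
    refine ⟨h1, h2.trans ?_⟩
    rw [chamberWeight_trace', ← sin_sub_int_mul_pi_sq (m * z.arg / 2)
      (⌊m * z.arg / (2 * Real.pi)⌋ + 1), ← neg_sq (Real.sin _), ← Real.sin_neg]
    congr 4
    push_cast
    field_simp
    ring

/-! ### Integrals over the angle -/

theorem image_sin_sq_Ioo :
    (fun φ : ℝ => Real.sin (φ / 2) ^ 2) '' Ioo 0 Real.pi = Ioo 0 1 := by
  ext v
  constructor
  · rintro ⟨φ, hφ, rfl⟩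
    have hs : 0 < Real.sin (φ / 2) :=
      Real.sin_pos_of_pos_of_lt_pi (by linarith [hφ.1]) (by linarith [hφ.1, hφ.2])
    have hc : 0 < Real.cos (φ / 2) :=
      Real.cos_pos_of_mem_Ioo ⟨by linarith [hφ.1, hφ.2], by linarith [hφ.2]⟩
    exact ⟨by positivity, by nlinarith [Real.sin_sq_add_cos_sq (φ / 2)]⟩
  · intro hv
    have hs0 : 0 < √v := Real.sqrt_pos.2 hv.1
    have hs1 : √v < 1 := (Real.sqrt_lt' one_pos).2 (by simpa using hv.2)
    refine ⟨2 * Real.arcsin √v, ⟨?_, ?_⟩, ?_⟩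
    · linarith [Real.arcsin_pos.2 hs0]
    · linarith [Real.arcsin_lt_pi_div_two.2 hs1]
    · simp only
      rw [mul_div_cancel_left₀ _ two_ne_zero, Real.sin_arcsin (by linarith) hs1.le,
        Real.sq_sqrt hv.1.le]

theorem integral_angle_substitution (g : ℝ → ℝ) :
    (IntervalIntegrable (fun v => g v * (v * (1 - v)) ^ (-(1 / 2) : ℝ)) volume 0 1 ↔
      IntervalIntegrable (fun φ => g (Real.sin (φ / 2) ^ 2)) volume 0 Real.pi) ∧
    ∫ v in (0 : ℝ)..1, g v * (v * (1 - v)) ^ (-(1 / 2) : ℝ) =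
      ∫ φ in (0 : ℝ)..Real.pi, g (Real.sin (φ / 2) ^ 2) := by
  have hderiv : ∀ φ ∈ Ioo 0 Real.pi, HasDerivWithinAt (fun φ : ℝ => Real.sin (φ / 2) ^ 2)
      (Real.sin (φ / 2) * Real.cos (φ / 2)) (Ioo 0 Real.pi) φ := by
    intro φ _
    have h := (((hasDerivAt_id φ).div_const 2).sin).pow 2
    refine (h.congr_deriv ?_).hasDerivWithinAt
    simp only [id]
    ring
  have hpos : ∀ φ ∈ Ioo 0 Real.pi, 0 < Real.sin (φ / 2) ∧ 0 < Real.cos (φ / 2) := fun φ hφ =>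
    ⟨Real.sin_pos_of_pos_of_lt_pi (by linarith [hφ.1]) (by linarith [hφ.1, hφ.2]),
      Real.cos_pos_of_mem_Ioo ⟨by linarith [hφ.1, hφ.2], by linarith [hφ.2]⟩⟩
  have hinj : InjOn (fun φ : ℝ => Real.sin (φ / 2) ^ 2) (Ioo 0 Real.pi) := by
    intro x hx y hy hxy
    have h := (pow_left_inj₀ (hpos x hx).1.le (hpos y hy).1.le two_ne_zero).1 hxy
    have h' := Real.injOn_sin ⟨by linarith [hx.1, hx.2], by linarith [hx.2]⟩
      ⟨by linarith [hy.1, hy.2], by linarith [hy.2]⟩ h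
    linarith
  have heq : EqOn (fun φ => |Real.sin (φ / 2) * Real.cos (φ / 2)| •
      (g (Real.sin (φ / 2) ^ 2) * (Real.sin (φ / 2) ^ 2 * (1 - Real.sin (φ / 2) ^ 2)) ^
        (-(1 / 2) : ℝ))) (fun φ => g (Real.sin (φ / 2) ^ 2)) (Ioo 0 Real.pi) := by
    intro φ hφ
    obtain ⟨hs, hc⟩ := hpos φ hφ
    have hsc := mul_pos hs hc
    have e : Real.sin (φ / 2) ^ 2 * (1 - Real.sin (φ / 2) ^ 2) =
        (Real.sin (φ / 2) * Real.cos (φ / 2)) ^ 2 := by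
      rw [← Real.cos_sq']
      ring
    simp only
    rw [e, Real.rpow_neg (by positivity), ← Real.sqrt_eq_rpow, Real.sqrt_sq hsc.le,
      abs_of_pos hsc, smul_eq_mul]
    field_simp
  constructor
  · rw [intervalIntegrable_iff_integrableOn_Ioo_of_le zero_le_one,
      intervalIntegrable_iff_integrableOn_Ioo_of_le Real.pi_pos.le, ← image_sin_sq_Ioo,
      integrableOn_image_iff_integrableOn_abs_deriv_smul measurableSet_Ioo hderiv hinj]
    exact integrableOn_congr_fun heq measurableSet_Ioo
  · rw [intervalIntegral.integral_of_le zero_le_one, integral_Ioc_eq_integral_Ioo,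
      intervalIntegral.integral_of_le Real.pi_pos.le, integral_Ioc_eq_integral_Ioo,
      ← image_sin_sq_Ioo,
      integral_image_eq_integral_abs_deriv_smul measurableSet_Ioo hderiv hinj]
    exact setIntegral_congr_fun measurableSet_Ioo heq

/-- The integrand in `φ = mθ` has period `2π` and is symmetric about `π`, so each of the `m` periods
contributes twice the integral over `(0,π)`; the Jacobian `1/m` cancels their number. -/
theorem integral_sin_sq_full_circle {g : ℝ → ℝ}
    (hg : IntervalIntegrable (fun φ => g (Real.sin (φ / 2) ^ 2)) volume 0 Real.pi)
    {m : ℕ} (hm : m ≠ 0) :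
    ∫ θ in (-Real.pi)..Real.pi, g (Real.sin (m * θ / 2) ^ 2) =
      2 * ∫ φ in (0 : ℝ)..Real.pi, g (Real.sin (φ / 2) ^ 2) := by
  have hm' : (m : ℝ) ≠ 0 := Nat.cast_ne_zero.2 hm
  set h : ℝ → ℝ := fun φ => g (Real.sin (φ / 2) ^ 2) with hh
  have hper : Function.Periodic h (2 * Real.pi) := fun φ => by
    simp only [hh]
    rw [show (φ + 2 * Real.pi) / 2 = φ / 2 + Real.pi by ring, Real.sin_add_pi, neg_sq]
  have hrefl : ∀ φ, h (2 * Real.pi - φ) = h φ := fun φ => by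
    simp only [hh]
    rw [show (2 * Real.pi - φ) / 2 = Real.pi - φ / 2 by ring, Real.sin_pi_sub]
  have hg2 : IntervalIntegrable h volume Real.pi (2 * Real.pi) := by
    have := hg.comp_sub_left (2 * Real.pi)
    simp only [hrefl] at this
    rw [sub_zero, show 2 * Real.pi - Real.pi = Real.pi by ring] at this
    exact this.symm
  have hint : ∀ a b, IntervalIntegrable h volume a b :=
    hper.intervalIntegrable (t := 0) (by linarith [Real.pi_pos]) (by
      rw [zero_add]
      exact hg.trans hg2)
  have h2 : ∫ φ in Real.pi..(2 * Real.pi), h φ = ∫ φ in (0 : ℝ)..Real.pi, h φ := by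
    have := intervalIntegral.integral_comp_sub_left (a := 0) (b := Real.pi) h (2 * Real.pi)
    simp only [hrefl] at this
    rw [this, sub_zero, show 2 * Real.pi - Real.pi = Real.pi by ring]
  have h3 := intervalIntegral.integral_comp_mul_left (a := -Real.pi) (b := Real.pi) h hm'
  have h4 := hper.intervalIntegral_add_zsmul_eq m (m * -Real.pi) hint
  rw [hper.intervalIntegral_add_eq _ 0, zero_add,
    ← intervalIntegral.integral_add_adjacent_intervals hg hg2, h2] at h4
  have e : (m * -Real.pi + (m : ℤ) • (2 * Real.pi) : ℝ) = m * Real.pi := by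
    simp only [zsmul_eq_mul, Int.cast_natCast]
    ring
  rw [e] at h4
  have h5 : ∫ θ in (-Real.pi)..Real.pi, g (Real.sin (m * θ / 2) ^ 2) =
      ∫ θ in (-Real.pi)..Real.pi, h (m * θ) := rfl
  rw [h5, h3, h4]
  simp only [zsmul_eq_mul, smul_eq_mul, Int.cast_natCast]
  field_simp
  ring

theorem integral_mul_exp_neg_sq_div_two :
    ∫ r in Ioi (0 : ℝ), r * Real.exp (-r ^ 2 / 2) = 1 := by
  have h := integral_rpow_mul_exp_neg_mul_rpow (p := 2) (q := 1) (b := 1 / 2) two_pos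
    (by norm_num) (by norm_num)
  norm_num at h
  rw [← h]
  refine setIntegral_congr_fun measurableSet_Ioi fun r _ => ?_
  ring_nf

/-- In polar coordinates the integrand is a product, and the radial factor integrates to `1`. The
product formula needs no integrability, so `g` is arbitrary. -/
theorem integral_gaussian_mul_angular (g : ℝ → ℝ) :
    ∫ z : ℂ, g z.arg * Real.exp (-‖z‖ ^ 2 / 2) = ∫ θ in (-Real.pi)..Real.pi, g θ := by
  rw [← Complex.integral_comp_polarCoord_symm]
  have heq : EqOn (fun p : ℝ × ℝ => p.1 • (g (Complex.polarCoord.symm p).arg *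
      Real.exp (-‖Complex.polarCoord.symm p‖ ^ 2 / 2)))
      (fun p => (p.1 * Real.exp (-p.1 ^ 2 / 2)) * g p.2) polarCoord.target := by
    intro p hp
    rw [polarCoord_target] at hp
    have hp1 : 0 < p.1 := hp.1
    have harg : (Complex.polarCoord.symm p).arg = p.2 := by
      rw [Complex.polarCoord_symm_apply, Complex.ofReal_cos, Complex.ofReal_sin]
      exact Complex.arg_mul_cos_add_sin_mul_I hp1 ⟨hp.2.1, hp.2.2.le⟩
    simp only
    rw [harg, Complex.norm_polarCoord_symm, abs_of_pos hp1, smul_eq_mul]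
    ring
  rw [setIntegral_congr_fun polarCoord.open_target.measurableSet heq, polarCoord_target,
    Measure.volume_eq_prod, setIntegral_prod_mul (fun r : ℝ => r * Real.exp (-r ^ 2 / 2)) g,
    integral_mul_exp_neg_sq_div_two, one_mul,
    intervalIntegral.integral_of_le (by linarith [Real.pi_pos]), integral_Ioc_eq_integral_Ioo]

theorem normalization_iff {c x y : ℝ} (hx : x ≠ 0) (hy : y ≠ 0) :
    ((2 * c * (2 * Real.pi * (x / y)) : ℝ) : ℂ) = 2 ↔ c = y / (2 * Real.pi * x) := by
  have hpi := Real.pi_ne_zero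
  rw [show (2 : ℂ) = ((2 : ℝ) : ℂ) by simp, Complex.ofReal_inj, eq_div_iff (by positivity)]
  constructor
  · intro h
    field_simp at h
    linarith
  · intro h
    field_simp
    linarith

end DihedralWeight


theorem proposition6p5 (κ δ : ℝ) (hκ : -(1 / 2) < κ) (hκ' : κ < 1 / 2)
    (hδ : 0 ≤ δ) (hδ' : δ < 1 / 2) :
    -- the integral converges and has the stated value
    (IntervalIntegrable (fun v : ℝ => DihedralWeight.G₁ κ δ v * (v * (1 - v)) ^ (-(1 / 2) : ℝ))
        MeasureTheory.volume 0 1 ∧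
      ∫ v in (0 : ℝ)..1, DihedralWeight.G₁ κ δ v * (v * (1 - v)) ^ (-(1 / 2) : ℝ) =
        2 * Real.pi * (Real.cos (δ * Real.pi) / Real.cos (κ * Real.pi))) ∧
    -- the normalization of the weight on the circle determines the constant
    (∀ (m : ℕ) (c : ℝ), 3 ≤ m →
      ((m : ℂ) * ∫ θ in (0 : ℝ)..(Real.pi / m),
          (DihedralWeight.toComplexBasis (DihedralWeight.chamberWeight c κ δ (m * θ)) 0 0 +
            DihedralWeight.toComplexBasis (DihedralWeight.chamberWeight c κ δ (m * θ)) 1 1) = 2 ↔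
        c = Real.cos (Real.pi * κ) / (2 * Real.pi * Real.cos (Real.pi * δ)))) ∧
    -- the normalization of the Gaussian form on the plane determines the constant
    (∀ (m ℓ : ℕ) (c : ℝ), 3 ≤ m → 1 ≤ ℓ → ℓ ≤ (m - 1) / 2 → δ = 1 / 2 - (ℓ : ℝ) / m →
      (∫ z : ℂ, DihedralWeight.toComplexBasis (DihedralWeight.planeWeight m ℓ c κ z) 0 0 *
          (Real.exp (-‖z‖ ^ 2 / 2) : ℂ) = 2 ↔
        c = Real.cos (Real.pi * κ) / (2 * Real.pi * Real.cos (Real.pi * δ)))) := by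
  open DihedralWeight in
  have hpi := Real.pi_pos
  obtain ⟨hint, hval⟩ := intervalIntegrable_G₁_and_integral_G₁ hκ hκ'
    (abs_lt.2 ⟨by linarith, by linarith⟩ : |δ| < 1)
  obtain ⟨hsub, hsubval⟩ := integral_angle_substitution (G₁ κ δ)
  have hangle := hsub.1 hint
  have hangleval := hsubval.symm.trans hval
  rw [mul_comm δ, mul_comm κ] at hangleval
  have hcosκ : Real.cos (Real.pi * κ) ≠ 0 :=
    (Real.cos_pos_of_mem_Ioo ⟨by nlinarith, by nlinarith⟩).ne'
  have hcosδ : Real.cos (Real.pi * δ) ≠ 0 :=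
    (Real.cos_pos_of_mem_Ioo ⟨by nlinarith, by nlinarith⟩).ne'
  refine ⟨⟨hint, hval⟩, fun m c hm => ?_, fun m ℓ c hm _ _ hδm => ?_⟩
  · have hm' : (m : ℝ) ≠ 0 := Nat.cast_ne_zero.2 (by omega)
    rw [← normalization_iff hcosδ hcosκ, ← hangleval]
    have e : ∀ θ : ℝ, toComplexBasis (chamberWeight c κ δ (m * θ)) 0 0 +
        toComplexBasis (chamberWeight c κ δ (m * θ)) 1 1 =
        ((2 * c * G₁ κ δ (Real.sin (m * θ / 2) ^ 2) : ℝ) : ℂ) := fun θ => by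
      rw [toComplexBasis_trace, chamberWeight_trace, mul_assoc]
    simp_rw [e]
    have h := intervalIntegral.integral_comp_mul_left (a := 0) (b := Real.pi / m)
      (fun φ => G₁ κ δ (Real.sin (φ / 2) ^ 2)) hm'
    rw [mul_zero, mul_div_cancel₀ _ hm', smul_eq_mul] at h
    -- The prefactor `m` cancels the Jacobian `1/m`, leaving `2c` times the integral over `(0,π)`.
    rw [intervalIntegral.integral_ofReal, intervalIntegral.integral_const_mul, h,
      ← Complex.ofReal_natCast, ← Complex.ofReal_mul]
    field_simp
  · have hm0 : m ≠ 0 := by omega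
    rw [← normalization_iff hcosδ hcosκ, ← hangleval]
    have e : ∀ z : ℂ, toComplexBasis (planeWeight m ℓ c κ z) 0 0 *
        (Real.exp (-‖z‖ ^ 2 / 2) : ℂ) =
        ((c * G₁ κ δ (Real.sin (m * z.arg / 2) ^ 2) * Real.exp (-‖z‖ ^ 2 / 2) : ℝ) : ℂ) :=
      fun z => by
        obtain ⟨h1, h2⟩ := planeWeight_isSymm_and_trace hm0 ℓ c κ z
        rw [toComplexBasis_zero_zero h1, h2, ← hδm, ← Complex.ofReal_mul]
    simp_rw [e]
    -- Here the factor `2` in `2c` comes from the full circle, whereas on the chamber it came from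
    -- the trace in the complex basis.
    rw [integral_complex_ofReal,
      integral_gaussian_mul_angular (fun θ => c * G₁ κ δ (Real.sin (m * θ / 2) ^ 2)),
      intervalIntegral.integral_const_mul, integral_sin_sq_full_circle hangle hm0,
      mul_left_comm, ← mul_assoc]
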